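/- Let $d,m\ge 1$, $\mu>0$, let $\|W\|_*$ be the trace norm (sum of the singular values) of $W\in\mathbb R^{d\times m}$, and let $\mathcal D=\{W\in\mathbb R^{d\times m}:\|W\|_*\le\mu\}$. Let $F=\sum_{i=1}^n f_i$, where each $f_i:\mathbb R^{d\times m}\to\mathbb R$ is differentiable at every point of $\mathcal D$, and assume that $F$ is convex on $\mathcal D$, that $|F(X)-F(Y)|\le L\|X-Y\|_*$ for all $X,Y\in\mathcal D$, and that the curvature constant $$C_F=\sup\Big\{\tfrac{2}{\gamma^2}\big(F(Y)-F(X)-\langle Y-X,\nabla F(X)\rangle\big): X,S\in\mathcal D,\ \gamma\in(0,1],\ Y=X+\gamma(S-X)\Big\}$$ is finite and positive. Let $W^*\in\mathcal D$ minimize $F$ over $\mathcal D$, and let $\delta>0$. The algorithm DFW-Trace with $K(t)$ power iterations at epoch $t$ is the following. The indices $1,\dots,n$ are partitioned into sets $I_1,\dots,I_N$, one per worker, and $F_j=\sum_{i\in I_j}f_i$. Start from any $W^0\in\mathcal D$. At epoch $t=0,1,2,\dots$, draw $v_0\in\mathbb R^m$ uniformly on the unit sphere, independently of all earlier draws; for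 $k=0,\dots,K(t)-1$ set $$u_{k+1}=\frac{\sum_{j=1}^N\nabla F_j(W^t)v_k}{\big\|\sum_{j=1}^N\nabla F_j(W^t)v_k\big\|},\qquad v_{k+1}=\frac{\sum_{j=1}^N\nabla F_j(W^t)^\top u_{k+1}}{\big\|\sum_{j=1}^N\nabla F_j(W^t)^\top u_{k+1}\big\|}$$ (a zero vector is left equal to zero when normalized); put $S^t=-\mu\,u_{K(t)}v_{K(t)}^\top$ and $W^{t+1}=(1-\gamma^t)W^t+\gamma^tS^t$, where $\gamma^t=\frac{2}{t+2}$ or $\gamma^t$ is determined by line search, i.e. $\gamma^t$ minimizes $s\mapsto F((1-s)W^t+sS^t)$ over $[0,1]$ (if there are several minimizers, one is chosen as a measurable function of $t$, $W^t$, $S^t$). We say that the run converges sublinearly in expectation if $\mathbb E[F(W^t)]-F(W^*)\le\frac{2C_F}{t+2}(1+\delta)$ for every $t\ge1$. Then the following hold. (1) If $m\ge 8$ and $K(t)\ge 1+\Big\lceil\frac{\mu L(t+2)\ln m}{\delta C_F}\Big\rceil$ for every $t\ge0$, then DFW-Trace converges sublinearly in expectation. (2) For every $\beta\in(0,1)$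 there is a constant $\widetilde K$, which depends neither on $t$ nor on the run of the algorithm, such that the following holds. Let $\sigma_1^t\ge\sigma_2^t$ be the two largest singular values of $\nabla F(W^t)$, counted with multiplicity ($\sigma_2^t=0$ if there is only one). If almost surely, for every $t\ge0$, $\sigma_1^t$ has multiplicity $1$ (i.e. $\sigma_2^t<\sigma_1^t$) and $\sigma_2^t/\sigma_1^t<\beta$, and if $$K(t)\ge\max\Big(\Big\lceil\frac{\ln(\delta C_F)-\ln[m\mu L(t+2)]}{2\ln\beta}\Big\rceil+1,\ \widetilde K\Big)\qquad\text{for every }t\ge0,$$ then DFW-Trace converges sublinearly in expectation. The right-hand side of the last display is $O(\log t)$ as $t\to\infty$, so that $K(t)=O(\log t)$ power iterations suffice. -/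

import Mathlib

open MeasureTheory ProbabilityTheory
open scoped Matrix.Norms.Frobenius

namespace DFWTrace

noncomputable section

/-- Real `d × m` matrices. -/
abbrev Mat (d m : ℕ) : Type := Matrix (Fin d) (Fin m) ℝ

/-- Euclidean space `ℝ^m`. -/
abbrev Vec (m : ℕ) : Type := EuclideanSpace ℝ (Fin m)

/-- Matrices carry their Borel σ-algebra. -/
instance instMeasurableSpaceMat (d m : ℕ) : MeasurableSpace (Mat d m) := borel _

instance instBorelSpaceMat (d m : ℕ) : BorelSpace (Mat d m) := ⟨rfl⟩

/-! ### Singular values, trace norm, trace-norm ball -/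

/-- The singular values of `A`, listed in decreasing order with multiplicity, zero-indexed:
`singVal A 0` is `σ₁(A)`, `singVal A 1` is `σ₂(A)`, and so on; the list is continued by zeros. -/
def singVal {d m : ℕ} (A : Mat d m) (k : ℕ) : ℝ :=
  (Matrix.toEuclideanLin A).singularValues k

/-- The trace norm: the sum of the singular values (those of index `≥ m` vanish). -/
def traceNorm {d m : ℕ} (A : Mat d m) : ℝ :=
  ∑ k ∈ Finset.range m, singVal A k

/-- The feasible domain `{W : ‖W‖_* ≤ μ}`. -/
def traceBall (d m : ℕ) (μ : ℝ) : Set (Mat d m) :=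
  {W | traceNorm W ≤ μ}

/-! ### Gradient and curvature constant -/

/-- The inner product `⟨A, B⟩ = tr(Aᵀ B)`. -/
def frobInner {d m : ℕ} (A B : Mat d m) : ℝ :=
  (A.transpose * B).trace

/-- The gradient of `f` at `W`: the matrix of partial derivatives. -/
def grad {d m : ℕ} (f : Mat d m → ℝ) (W : Mat d m) : Mat d m :=
  Matrix.of fun i j => fderiv ℝ f W (Matrix.single i j 1)

/-- All quotients `(2 / γ²) (F(Y) - F(X) - ⟨Y - X, ∇F(X)⟩)` with `X`, `S` in the trace-norm ball,
`γ ∈ (0, 1]` and `Y = X + γ (S - X)`. -/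
def curvatureSet {d m : ℕ} (F : Mat d m → ℝ) (μ : ℝ) : Set ℝ :=
  {c | ∃ X ∈ traceBall d m μ, ∃ S ∈ traceBall d m μ, ∃ γ ∈ Set.Ioc (0 : ℝ) 1,
    c = 2 / γ ^ 2 *
      (F (X + γ • (S - X)) - F X - frobInner (X + γ • (S - X) - X) (grad F X))}

/-- The curvature constant `C_F` of `F` over the trace-norm ball of radius `μ`
(meaningful when `curvatureSet F μ` is bounded above). -/
def curvature {d m : ℕ} (F : Mat d m → ℝ) (μ : ℝ) : ℝ :=
  sSup (curvatureSet F μ)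

/-! ### The algorithm DFW-Trace -/

/-- The objective `F = ∑ i, f i`. -/
def objective {d m n : ℕ} (f : Fin n → Mat d m → ℝ) : Mat d m → ℝ :=
  fun W => ∑ i, f i W

/-- The gradient computed by worker `j`: the sum of `∇ f i (W)` over the indices `i` that are
assigned to `j`. -/
def localGrad {d m n N : ℕ} (f : Fin n → Mat d m → ℝ) (owner : Fin n → Fin N)
    (W : Mat d m) (j : Fin N) : Mat d m :=
  ∑ i with owner i = j, grad (f i) W

/-- The distributed power method run on the local matrices `G 1, …, G N` from `v₀`: the value at `k`
is the pair `(u_k, v_k)`, where the master aggregates and normalizes,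
`u_{k+1} = (∑ j, G j v_k) / ‖∑ j, G j v_k‖` and
`v_{k+1} = (∑ j, (G j)ᵀ u_{k+1}) / ‖∑ j, (G j)ᵀ u_{k+1}‖`.
The zero vector is normalized to zero. There is no `u_0`; the entry is filled with `0`. -/
def powerMethod {d m N : ℕ} (G : Fin N → Mat d m) (v₀ : Vec m) : ℕ → Vec d × Vec m
  | 0 => (0, v₀)
  | k + 1 =>
    let u : Vec d :=
      NormedSpace.normalize (∑ j, Matrix.toEuclideanLin (G j) (powerMethod G v₀ k).2)
    (u, NormedSpace.normalize (∑ j, Matrix.toEuclideanLin (G j).transpose u))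

/-- The approximate solution `-μ u_K v_Kᵀ` of the linear subproblem given by `K` power
iterations started at `v₀`. -/
def subproblemSol {d m N : ℕ} (μ : ℝ) (G : Fin N → Mat d m) (v₀ : Vec m) (K : ℕ) : Mat d m :=
  -(μ • Matrix.vecMulVec (WithLp.ofLp (powerMethod G v₀ K).1) (WithLp.ofLp (powerMethod G v₀ K).2))

/-- Admissible step sizes. At epoch `t`, from the iterate `W` in direction `S`, the step
`γ t W S` is either the default `2 / (t + 2)`, or found by line search, i.e. it minimizes
`s ↦ F((1 - s) W + s S)` over `[0, 1]`. The choice has to be measurable (this is automatic for the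
default step, and matters for line search only when there are several minimizers). -/
structure IsStepSizeRule {d m : ℕ} (F : Mat d m → ℝ) (μ : ℝ)
    (γ : ℕ → Mat d m → Mat d m → ℝ) : Prop where
  measurable : ∀ t, Measurable fun p : Mat d m × Mat d m => γ t p.1 p.2
  step : ∀ t, ∀ W ∈ traceBall d m μ, ∀ S ∈ traceBall d m μ,
    γ t W S = 2 / ((t : ℝ) + 2) ∨
      (γ t W S ∈ Set.Icc (0 : ℝ) 1 ∧ ∀ s ∈ Set.Icc (0 : ℝ) 1,
        F ((1 - γ t W S) • W + γ t W S • S) ≤ F ((1 - s) • W + s • S))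

/-- The uniform probability distribution on the unit sphere of `ℝ^m` (for `m ≥ 1`). -/
def uniformSphere (m : ℕ) : Measure (Metric.sphere (0 : Vec m) 1) :=
  ((volume : Measure (Vec m)).toSphere Set.univ)⁻¹ • (volume : Measure (Vec m)).toSphere

/-- `W 0, W 1, …` are the (random) iterates of DFW-Trace, run with `K t` power iterations at
epoch `t`, on the objective `∑ i, f i` over the trace-norm ball of radius `μ`, the function `f i`
being held by the worker `owner i`. The starting point `W₀` is any feasible point, the step sizes
follow any admissible rule, and the starting vectors `v t` of the power method are independent
and uniform on the unit sphere. -/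
def IsDFWTrace {d m n N : ℕ} {Ω : Type*} [MeasurableSpace Ω] (P : Measure Ω)
    (f : Fin n → Mat d m → ℝ) (owner : Fin n → Fin N) (μ : ℝ) (K : ℕ → ℕ)
    (W : ℕ → Ω → Mat d m) : Prop :=
  ∃ W₀ ∈ traceBall d m μ, ∃ γ : ℕ → Mat d m → Mat d m → ℝ,
    IsStepSizeRule (objective f) μ γ ∧
    ∃ v : ℕ → Ω → Metric.sphere (0 : Vec m) 1,
      (∀ t, Measurable (v t)) ∧ iIndepFun v P ∧ (∀ t, P.map (v t) = uniformSphere m) ∧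
      (∀ ω, W 0 ω = W₀) ∧
      ∀ t ω,
        let S := subproblemSol μ (localGrad f owner (W t ω)) (v t ω : Vec m) (K t)
        let g := γ t (W t ω) S
        W (t + 1) ω = (1 - g) • W t ω + g • S

/-- Sublinear convergence in expectation with accuracy parameter `δ`: for each `t ≥ 1`,
`E[F(W^t)] - F(W*) ≤ (2 C_F / (t + 2)) (1 + δ)`, the expectation being well defined. -/
def ConvergesSublinearly {d m : ℕ} {Ω : Type*} [MeasurableSpace Ω] (P : Measure Ω)
    (F : Mat d m → ℝ) (μ δ : ℝ) (Wstar : Mat d m) (W : ℕ → Ω → Mat d m) : Prop :=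
  ∀ t : ℕ, 1 ≤ t →
    Integrable (fun ω => F (W t ω)) P ∧
    ∫ ω, F (W t ω) ∂P - F Wstar ≤ 2 * curvature F μ / ((t : ℝ) + 2) * (1 + δ)

/-- The number of power iterations `1 + ⌈μ L (t + 2) ln m / (δ C)⌉`. -/
def linearSchedule (m : ℕ) (μ L δ C : ℝ) (t : ℕ) : ℤ :=
  1 + ⌈μ * L * ((t : ℝ) + 2) * Real.log m / (δ * C)⌉

/-- The number of power iterations
`max(⌈(ln (δ C) - ln (m μ L (t + 2))) / (2 ln β)⌉ + 1, K₀)`. -/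
def logSchedule (m : ℕ) (μ L δ C β : ℝ) (K₀ : ℕ) (t : ℕ) : ℤ :=
  max (⌈(Real.log (δ * C) - Real.log ((m : ℝ) * μ * L * ((t : ℝ) + 2))) / (2 * Real.log β)⌉ + 1)
    (K₀ : ℤ)

end

end DFWTrace

/-! Frank-Wolfe tolerates inexact linear subproblems. With g = 2/(t+2), the curvature constant C,
convexity, and the duality of trace and spectral norms show that one step multiplies the gap to the
minimum by 1 - g and adds g²C/2 + gμ(σ₁ - ρ). Here σ₁ is the spectral norm of the gradient A, and ρ
= uᵀAv is the value reached by the power method (`frankWolfe_step`). If the expectation of μ(σ₁ - ρ)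
is at most δC/(t+2), the error is absorbed by replacing C with C(1+δ), and `frankWolfe_recursion`
gives the rate. Line search does at least as well as the default step.

It remains to bound E[σ₁ - ρ] for a uniform start. After k+1 iterations ρ² is the ratio of the
moments of orders 2k+2 and 2k+1 of the values σᵢ², weighted by the squared coordinates of v₀ in a
right singular basis (`ritzValue_sq`). Let a be the absolute value of the top coordinate. Jensen's
inequality gives ρ ≥ σ₁ a^(1/(2k+1)) without any gap. If σ₂ ≤ βσ₁, then ρ ≥ σ₁ a/√(a² + ε²) with ε =
β^(2k+1).

The randomness enters only through the small-ball estimate P(a ≤ s) ≤ ms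
(`uniformSphere_abs_inner_le`). It gives E[-log a] ≤ log m + 1 and E[1 - a/√(a² + ε²)] ≤ mε. Since
σ₁ ≤ max L 0 by the Lipschitz hypothesis, both schedules follow. These bounds hold for a fixed
matrix; they apply at epoch t because the fresh vector v_t is independent of W^t
(`indepFun_of_recursion`). -/

namespace DFWTrace

/-! ### Singular values -/

section LinearAlgebra

variable {d m : ℕ}

/-- The linear map `x ↦ A x` between Euclidean spaces, as a continuous linear map. -/
noncomputable def euclideanCLM (A : Mat d m) : Vec m →L[ℝ] Vec d :=
  LinearMap.toContinuousLinearMap (Matrix.toEuclideanLin A)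

/-- The spectral norm. -/
noncomputable def spectralNorm (A : Mat d m) : ℝ := ‖euclideanCLM A‖

@[simp]
theorem euclideanCLM_apply (A : Mat d m) (x : Vec m) :
    euclideanCLM A x = Matrix.toEuclideanLin A x := rfl

theorem spectralNorm_nonneg (A : Mat d m) : 0 ≤ spectralNorm A := norm_nonneg _

theorem norm_toEuclideanLin_le (A : Mat d m) (x : Vec m) :
    ‖Matrix.toEuclideanLin A x‖ ≤ spectralNorm A * ‖x‖ :=
  (euclideanCLM A).le_opNorm x

theorem continuous_euclideanCLM : Continuous (euclideanCLM : Mat d m → Vec m →L[ℝ] Vec d) :=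
  LinearMap.continuous_of_finiteDimensional
    (LinearMap.toContinuousLinearMap.toLinearMap ∘ₗ
      (Matrix.toEuclideanLin (𝕜 := ℝ) (m := Fin d) (n := Fin m)).toLinearMap)

theorem continuous_spectralNorm : Continuous (spectralNorm : Mat d m → ℝ) :=
  continuous_norm.comp continuous_euclideanCLM

theorem continuous_toEuclideanLin_apply :
    Continuous fun p : Mat d m × Vec m => Matrix.toEuclideanLin p.1 p.2 :=
  isBoundedBilinearMap_apply.continuous.comp
    ((continuous_euclideanCLM.comp continuous_fst).prodMk continuous_snd)

theorem adjoint_toEuclideanLin (A : Mat d m) :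
    LinearMap.adjoint (Matrix.toEuclideanLin A) = Matrix.toEuclideanLin A.transpose := by
  rw [← Matrix.toEuclideanLin_conjTranspose_eq_adjoint, Matrix.conjTranspose_eq_transpose_of_trivial]

theorem inner_toEuclideanLin_transpose (A : Mat d m) (x : Vec m) (y : Vec d) :
    inner ℝ (Matrix.toEuclideanLin A.transpose y) x = inner ℝ y (Matrix.toEuclideanLin A x) := by
  rw [← adjoint_toEuclideanLin, LinearMap.adjoint_inner_left]

theorem singVal_nonneg (A : Mat d m) (k : ℕ) : 0 ≤ singVal A k :=
  LinearMap.singularValues_nonneg _ k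

theorem singVal_antitone (A : Mat d m) : Antitone (singVal A) :=
  LinearMap.singularValues_antitone _

/-- An orthonormal basis of right singular vectors. -/
theorem exists_rightSingularBasis (A : Mat d m) :
    ∃ b : OrthonormalBasis (Fin m) ℝ (Vec m), ∀ i,
      Matrix.toEuclideanLin A.transpose (Matrix.toEuclideanLin A (b i)) =
        (singVal A i) ^ 2 • b i := by
  have hn : Module.finrank ℝ (Vec m) = m := finrank_euclideanSpace_fin
  refine ⟨(Matrix.toEuclideanLin A).isSymmetric_adjoint_comp_self.eigenvectorBasis hn,
    fun i => ?_⟩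
  have h := (Matrix.toEuclideanLin A).isSymmetric_adjoint_comp_self.apply_eigenvectorBasis hn i
  rw [← LinearMap.sq_singularValues_fin] at h
  rw [← adjoint_toEuclideanLin]
  exact h

theorem norm_apply_rightSingularBasis {A : Mat d m} {x : Vec m} (hx : ‖x‖ = 1) {s : ℝ}
    (hs : 0 ≤ s)
    (h : Matrix.toEuclideanLin A.transpose (Matrix.toEuclideanLin A x) = s ^ 2 • x) :
    ‖Matrix.toEuclideanLin A x‖ = s := by
  have h1 : ‖Matrix.toEuclideanLin A x‖ ^ 2 = s ^ 2 := by
    rw [← real_inner_self_eq_norm_sq, ← inner_toEuclideanLin_transpose, h, real_inner_smul_left,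
      real_inner_self_eq_norm_sq, hx]
    ring
  exact (pow_left_inj₀ (norm_nonneg _) hs two_ne_zero).1 h1

theorem spectralNorm_eq_singVal (A : Mat d m) (hm : 0 < m) : spectralNorm A = singVal A 0 := by
  obtain ⟨b, hb⟩ := exists_rightSingularBasis A
  refine le_antisymm ?_ ?_
  · refine ContinuousLinearMap.opNorm_le_bound _ (singVal_nonneg A 0) fun x => ?_
    refine le_of_sq_le_sq ?_ (mul_nonneg (singVal_nonneg A 0) (norm_nonneg _))
    rw [euclideanCLM_apply, ← real_inner_self_eq_norm_sq, ← inner_toEuclideanLin_transpose,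
      ← b.sum_inner_mul_inner, mul_pow, ← b.sum_sq_norm_inner_right x, Finset.mul_sum]
    refine Finset.sum_le_sum fun i _ => ?_
    rw [inner_toEuclideanLin_transpose, real_inner_comm, ← inner_toEuclideanLin_transpose, hb,
      real_inner_smul_left, Real.norm_eq_abs, sq_abs, mul_assoc, ← sq]
    exact mul_le_mul_of_nonneg_right
      (pow_le_pow_left₀ (singVal_nonneg A i) (singVal_antitone A (Nat.zero_le _)) 2)
      (sq_nonneg _)
  · have h := norm_apply_rightSingularBasis (b.norm_eq_one ⟨0, hm⟩) (singVal_nonneg A 0)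
      (hb ⟨0, hm⟩)
    rw [← h]
    simpa using norm_toEuclideanLin_le A (b ⟨0, hm⟩)

/-- The trace may be computed in any orthonormal basis. For a right singular basis of `A` the
vectors A bᵢ have norms σᵢ(A), which yields the duality bound. -/
theorem frobInner_eq_sum_inner (A B : Mat d m) (b : OrthonormalBasis (Fin m) ℝ (Vec m)) :
    frobInner A B =
      ∑ i, inner ℝ (Matrix.toEuclideanLin A (b i)) (Matrix.toEuclideanLin B (b i)) := by
  have h : LinearMap.trace ℝ (Vec m) (Matrix.toEuclideanLin (A.transpose * B)) =
      (A.transpose * B).trace := by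
    rw [Matrix.toEuclideanLin_eq_toLin_orthonormal, Matrix.trace_toLin_eq]
  rw [frobInner, ← h, LinearMap.trace_eq_sum_inner _ b]
  refine Finset.sum_congr rfl fun i _ => ?_
  rw [real_inner_comm, real_inner_comm (Matrix.toEuclideanLin B (b i)),
    ← inner_toEuclideanLin_transpose]
  congr 1
  simp [Matrix.toLpLin_apply, Matrix.mulVec_mulVec]

/-- Duality between the trace norm and the spectral norm. -/
theorem abs_frobInner_le (A B : Mat d m) :
    |frobInner A B| ≤ traceNorm A * spectralNorm B := by
  obtain ⟨b, hb⟩ := exists_rightSingularBasis A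
  rw [frobInner_eq_sum_inner A B b, traceNorm, Finset.sum_range, Finset.sum_mul]
  refine (Finset.abs_sum_le_sum_abs _ _).trans (Finset.sum_le_sum fun i _ => ?_)
  refine (abs_real_inner_le_norm _ _).trans ?_
  rw [norm_apply_rightSingularBasis (b.norm_eq_one i) (singVal_nonneg A i) (hb i)]
  refine mul_le_mul_of_nonneg_left ?_ (singVal_nonneg A i)
  simpa using norm_toEuclideanLin_le B (b i)

theorem traceNorm_nonneg (A : Mat d m) : 0 ≤ traceNorm A :=
  Finset.sum_nonneg fun k _ => singVal_nonneg A k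

@[simp]
theorem traceNorm_zero : traceNorm (0 : Mat d m) = 0 := by
  simp [traceNorm, singVal]

theorem toEuclideanLin_vecMulVec (u : Vec d) (v x : Vec m) :
    Matrix.toEuclideanLin (Matrix.vecMulVec (WithLp.ofLp u) (WithLp.ofLp v)) x =
      inner ℝ v x • u := by
  ext i
  simp only [Matrix.toLpLin_apply, Matrix.vecMulVec_mulVec]
  simp [EuclideanSpace.inner_eq_star_dotProduct, dotProduct_comm, mul_comm]

/-- The matrix has rank at most one, so only the first singular value survives, and that one is the
spectral norm. -/
theorem traceNorm_vecMulVec_le (u : Vec d) (v : Vec m) :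
    traceNorm (Matrix.vecMulVec (WithLp.ofLp u) (WithLp.ofLp v)) ≤ ‖u‖ * ‖v‖ := by
  set A : Mat d m := Matrix.vecMulVec (WithLp.ofLp u) (WithLp.ofLp v) with hA
  rcases Nat.eq_zero_or_pos m with hm | hm
  · subst hm
    simp only [traceNorm, Finset.range_zero, Finset.sum_empty]
    positivity
  have hrank : ∀ k, 1 ≤ k → singVal A k = 0 := by
    intro k hk
    refine (LinearMap.singularValues_eq_zero_iff_le_finrank_range _).2 (le_trans ?_ hk)
    have hle : LinearMap.range (Matrix.toEuclideanLin A) ≤ Submodule.span ℝ {u} := by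
      rintro _ ⟨x, rfl⟩
      rw [hA, toEuclideanLin_vecMulVec]
      exact Submodule.smul_mem _ _ (Submodule.mem_span_singleton_self u)
    exact (Submodule.finrank_mono hle).trans ((finrank_span_le_card _).trans (by simp))
  rw [traceNorm, Finset.sum_eq_single_of_mem 0 (Finset.mem_range.2 hm)
    fun k _ hk => hrank k (Nat.one_le_iff_ne_zero.2 hk), ← spectralNorm_eq_singVal A hm]
  refine ContinuousLinearMap.opNorm_le_bound _ (by positivity) fun x => ?_
  rw [euclideanCLM_apply, hA, toEuclideanLin_vecMulVec, norm_smul, mul_comm, mul_assoc]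
  exact mul_le_mul_of_nonneg_left (abs_real_inner_le_norm v x) (norm_nonneg u)

theorem frobInner_vecMulVec (u : Vec d) (v : Vec m) (B : Mat d m) :
    frobInner (Matrix.vecMulVec (WithLp.ofLp u) (WithLp.ofLp v)) B =
      inner ℝ u (Matrix.toEuclideanLin B v) := by
  rw [frobInner, Matrix.transpose_vecMulVec, Matrix.vecMulVec_mul, Matrix.trace_vecMulVec,
    EuclideanSpace.inner_eq_star_dotProduct]
  simp [Matrix.toLpLin_apply, dotProduct_comm, Matrix.dotProduct_mulVec]

@[simp]
theorem frobInner_neg_left (A B : Mat d m) : frobInner (-A) B = -frobInner A B := by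
  simp [frobInner]

@[simp]
theorem frobInner_smul_left (c : ℝ) (A B : Mat d m) :
    frobInner (c • A) B = c * frobInner A B := by
  simp [frobInner]

@[simp]
theorem frobInner_sub_left (A A' B : Mat d m) :
    frobInner (A - A') B = frobInner A B - frobInner A' B := by
  simp [frobInner, Matrix.sub_mul]

theorem zero_mem_traceBall {μ : ℝ} (hμ : 0 ≤ μ) : (0 : Mat d m) ∈ traceBall d m μ := by
  simpa [traceBall] using hμ

theorem smul_vecMulVec_mem_traceBall {μ : ℝ} (hμ : 0 ≤ μ) (c : ℝ) (hc : |c| ≤ μ) {u : Vec d}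
    {v : Vec m} (hu : ‖u‖ ≤ 1) (hv : ‖v‖ ≤ 1) :
    c • Matrix.vecMulVec (WithLp.ofLp u) (WithLp.ofLp v) ∈ traceBall d m μ := by
  have h := traceNorm_vecMulVec_le (c • u) v
  rw [WithLp.ofLp_smul, Matrix.smul_vecMulVec, norm_smul, Real.norm_eq_abs, mul_assoc] at h
  refine h.trans ?_
  calc |c| * (‖u‖ * ‖v‖) ≤ μ * (1 * 1) := by gcongr
    _ = μ := by ring

end LinearAlgebra

/-! ### The power method -/

section PowerMethod

variable {d m N : ℕ}

/-- The singular value estimate `u_Kᵀ (∑ j, G j) v_K` produced by the power method. -/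
noncomputable def ritzValue (G : Fin N → Mat d m) (v₀ : Vec m) (K : ℕ) : ℝ :=
  inner ℝ (powerMethod G v₀ K).1 (Matrix.toEuclideanLin (∑ j, G j) (powerMethod G v₀ K).2)

theorem sum_toEuclideanLin (G : Fin N → Mat d m) (x : Vec m) :
    ∑ j, Matrix.toEuclideanLin (G j) x = Matrix.toEuclideanLin (∑ j, G j) x := by
  simp [map_sum]

theorem sum_toEuclideanLin_transpose (G : Fin N → Mat d m) (x : Vec d) :
    ∑ j, Matrix.toEuclideanLin (G j).transpose x =
      Matrix.toEuclideanLin (∑ j, G j).transpose x := by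
  simp [Matrix.transpose_sum, map_sum]

theorem norm_normalize_le {V : Type*} [NormedAddCommGroup V] [NormedSpace ℝ V] (x : V) :
    ‖NormedSpace.normalize x‖ ≤ 1 := by
  rcases eq_or_ne x 0 with rfl | hx
  · simp
  · exact (NormedSpace.norm_normalize_eq_one_iff.2 hx).le

theorem normalize_map_normalize {V V' : Type*} [NormedAddCommGroup V] [NormedSpace ℝ V]
    [NormedAddCommGroup V'] [NormedSpace ℝ V'] (f : V →ₗ[ℝ] V') (x : V) :
    NormedSpace.normalize (f (NormedSpace.normalize x)) = NormedSpace.normalize (f x) := by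
  rcases eq_or_ne x 0 with rfl | hx
  · simp
  · rw [show NormedSpace.normalize x = ‖x‖⁻¹ • x from rfl, map_smul,
      NormedSpace.normalize_smul_of_pos (inv_pos.2 (norm_pos_iff.2 hx))]

theorem norm_powerMethod_fst_le (G : Fin N → Mat d m) (v₀ : Vec m) (K : ℕ) :
    ‖(powerMethod G v₀ K).1‖ ≤ 1 := by
  cases K with
  | zero => simp [powerMethod]
  | succ k => exact norm_normalize_le _

theorem norm_powerMethod_snd_le (G : Fin N → Mat d m) {v₀ : Vec m} (h : ‖v₀‖ ≤ 1) (K : ℕ) :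
    ‖(powerMethod G v₀ K).2‖ ≤ 1 := by
  cases K with
  | zero => simpa [powerMethod] using h
  | succ k => exact norm_normalize_le _

theorem abs_ritzValue_le (G : Fin N → Mat d m) {v₀ : Vec m} (h : ‖v₀‖ ≤ 1) (K : ℕ) :
    |ritzValue G v₀ K| ≤ spectralNorm (∑ j, G j) := by
  refine (abs_real_inner_le_norm _ _).trans ?_
  have h1 := norm_powerMethod_fst_le G v₀ K
  have h2 := norm_powerMethod_snd_le G h K
  have h3 := norm_toEuclideanLin_le (∑ j, G j) (powerMethod G v₀ K).2
  calc _ ≤ 1 * (spectralNorm (∑ j, G j) * 1) := by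
        refine mul_le_mul h1 (h3.trans ?_) (norm_nonneg _) zero_le_one
        exact mul_le_mul_of_nonneg_left h2 (spectralNorm_nonneg _)
    _ = _ := by ring

/-- The map `x ↦ Aᵀ A x`. -/
noncomputable def gramMap (A : Mat d m) : Vec m →ₗ[ℝ] Vec m :=
  Matrix.toEuclideanLin A.transpose ∘ₗ Matrix.toEuclideanLin A

/-- Normalization ignores positive scalars, so all intermediate normalizations can be postponed to
the end. The convention at zero makes this hold for vanishing iterates too. -/
theorem powerMethod_snd_eq (G : Fin N → Mat d m) {v₀ : Vec m} (h : ‖v₀‖ = 1) (k : ℕ) :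
    (powerMethod G v₀ k).2 = NormedSpace.normalize ((gramMap (∑ j, G j) ^ k) v₀) := by
  induction k with
  | zero => simp [powerMethod, NormedSpace.normalize_eq_self_of_norm_eq_one h]
  | succ k ih =>
    rw [powerMethod]
    simp only
    rw [sum_toEuclideanLin G, sum_toEuclideanLin_transpose G, normalize_map_normalize, ih, pow_succ']
    exact normalize_map_normalize (gramMap (∑ j, G j)) _

/-- With y = Aᵀu, the value uᵀAv is the inner product of y with its own normalization, hence ‖y‖,
where u is the normalization of Az. -/
theorem ritzValue_succ (G : Fin N → Mat d m) {v₀ : Vec m} (h : ‖v₀‖ = 1) (k : ℕ) :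
    ritzValue G v₀ (k + 1) =
      ‖gramMap (∑ j, G j) ((gramMap (∑ j, G j) ^ k) v₀)‖ /
        ‖Matrix.toEuclideanLin (∑ j, G j) ((gramMap (∑ j, G j) ^ k) v₀)‖ := by
  rw [ritzValue, powerMethod]
  simp only
  rw [sum_toEuclideanLin G, sum_toEuclideanLin_transpose G, ← inner_toEuclideanLin_transpose,
    powerMethod_snd_eq G h, normalize_map_normalize]
  set A := ∑ j, G j
  set z := (gramMap A ^ k) v₀
  have key : ∀ y : Vec m, inner ℝ y (NormedSpace.normalize y) = ‖y‖ := by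
    intro y
    rcases eq_or_ne y 0 with rfl | hy
    · simp
    · have : ‖y‖ ≠ 0 := norm_ne_zero_iff.2 hy
      rw [NormedSpace.normalize, real_inner_smul_right, real_inner_self_eq_norm_sq]
      field_simp
  rw [key]
  simp only [NormedSpace.normalize, map_smul, norm_smul, norm_inv, norm_norm]
  rw [div_eq_inv_mul]
  rfl

theorem inner_gramMap_pow {A : Mat d m} {b : OrthonormalBasis (Fin m) ℝ (Vec m)}
    (hb : ∀ i, Matrix.toEuclideanLin A.transpose (Matrix.toEuclideanLin A (b i)) =
      (singVal A i) ^ 2 • b i) (k : ℕ) (i : Fin m) (v : Vec m) :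
    inner ℝ (b i) ((gramMap A ^ k) v) = (singVal A i ^ 2) ^ k * inner ℝ (b i) v := by
  induction k generalizing v with
  | zero => simp
  | succ k ih =>
    rw [pow_succ, Module.End.mul_apply, ih, gramMap, LinearMap.comp_apply, real_inner_comm,
      inner_toEuclideanLin_transpose, real_inner_comm, ← inner_toEuclideanLin_transpose, hb,
      real_inner_smul_left]
    ring

/-- For z = (AᵀA)^k v₀, Parseval expresses ‖AᵀAz‖² and ‖Az‖² = ⟨AᵀAz, z⟩ as spectral moments of AᵀA,
of orders 2k+2 and 2k+1. -/
theorem ritzValue_sq (G : Fin N → Mat d m) {b : OrthonormalBasis (Fin m) ℝ (Vec m)}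
    (hb : ∀ i, Matrix.toEuclideanLin (∑ j, G j).transpose
      (Matrix.toEuclideanLin (∑ j, G j) (b i)) = (singVal (∑ j, G j) i) ^ 2 • b i)
    {v₀ : Vec m} (h : ‖v₀‖ = 1) (k : ℕ) :
    ritzValue G v₀ (k + 1) ^ 2 =
      (∑ i : Fin m, inner ℝ (b i) v₀ ^ 2 * (singVal (∑ j, G j) i ^ 2) ^ (2 * k + 2)) /
        ∑ i : Fin m, inner ℝ (b i) v₀ ^ 2 * (singVal (∑ j, G j) i ^ 2) ^ (2 * k + 1) := by
  rw [ritzValue_succ G h, div_pow]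
  congr 1
  · rw [← Module.End.mul_apply, ← pow_succ', ← b.sum_sq_norm_inner_right]
    refine Finset.sum_congr rfl fun i _ => ?_
    rw [inner_gramMap_pow hb, Real.norm_eq_abs, sq_abs]
    ring
  · rw [← real_inner_self_eq_norm_sq, ← inner_toEuclideanLin_transpose, ← b.sum_inner_mul_inner]
    refine Finset.sum_congr rfl fun i _ => ?_
    rw [inner_gramMap_pow hb, real_inner_comm]
    have := inner_gramMap_pow hb (k + 1) i v₀
    rw [pow_succ', Module.End.mul_apply, gramMap, LinearMap.comp_apply] at this
    rw [gramMap, this]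
    ring

theorem ritzValue_succ_nonneg (G : Fin N → Mat d m) {v₀ : Vec m} (h : ‖v₀‖ = 1) (k : ℕ) :
    0 ≤ ritzValue G v₀ (k + 1) := by
  rw [ritzValue_succ G h]
  positivity

/-- Ratios of consecutive moments dominate powers of the moments. -/
theorem rpow_le_moment_ratio {ι : Type*} [Fintype ι] (w x : ι → ℝ) (hw : ∀ i, 0 ≤ w i)
    (hw1 : ∑ i, w i = 1) (hx : ∀ i, 0 ≤ x i) {p : ℕ} (hp : p ≠ 0)
    (hM : 0 < ∑ i, w i * x i ^ p) :
    (∑ i, w i * x i ^ p) ^ (1 / (p : ℝ)) ≤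
      (∑ i, w i * x i ^ (p + 1)) / ∑ i, w i * x i ^ p := by
  have hp' : (0 : ℝ) < p := by positivity
  rw [le_div_iff₀ hM]
  -- Jensen for the exponent 1 + 1/p applied to the values xᵢ^p turns moment p into moment p + 1.
  have h := Real.rpow_arith_mean_le_arith_mean_rpow Finset.univ w (fun i => x i ^ p)
    (fun i _ => hw i) hw1 (fun i _ => pow_nonneg (hx i) p) (p := 1 / (p : ℝ) + 1)
    (by have : 0 < 1 / (p : ℝ) := by positivity
        linarith)
  rw [Real.rpow_add hM, Real.rpow_one] at h
  refine h.trans (le_of_eq (Finset.sum_congr rfl fun i _ => ?_))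
  rw [← Real.rpow_natCast (x i) p, ← Real.rpow_mul (hx i), ← Real.rpow_natCast]
  congr 2
  push_cast
  field_simp
  ring

/-- A gap-free error bound for the power method. -/
theorem spectralNorm_sub_ritzValue_le_log (G : Fin N → Mat d m) (hm : 0 < m)
    {b : OrthonormalBasis (Fin m) ℝ (Vec m)}
    (hb : ∀ i, Matrix.toEuclideanLin (∑ j, G j).transpose
      (Matrix.toEuclideanLin (∑ j, G j) (b i)) = (singVal (∑ j, G j) i) ^ 2 • b i)
    {v₀ : Vec m} (h : ‖v₀‖ = 1) (k : ℕ) (h0 : inner ℝ (b ⟨0, hm⟩) v₀ ≠ 0) :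
    spectralNorm (∑ j, G j) - ritzValue G v₀ (k + 1) ≤
      spectralNorm (∑ j, G j) * (-Real.log |inner ℝ (b ⟨0, hm⟩) v₀| / (2 * k + 1)) := by
  have hR0 := ritzValue_succ_nonneg G h k
  have hsq := ritzValue_sq G hb h k
  rw [spectralNorm_eq_singVal _ hm]
  set A := ∑ j, G j
  set s := singVal A 0 with hs
  set a := |inner ℝ (b ⟨0, hm⟩) v₀| with ha
  have ha0 : 0 < a := abs_pos.2 h0
  rcases (singVal_nonneg A 0).eq_or_lt with hs0 | hs0
  · rw [hs, ← hs0]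
    simpa using hR0
  set w : Fin m → ℝ := fun i => inner ℝ (b i) v₀ ^ 2
  set x : Fin m → ℝ := fun i => singVal A i ^ 2
  have hw1 : ∑ i, w i = 1 := by
    have := b.sum_sq_norm_inner_right v₀
    simpa [h, sq_abs] using this
  have hle : a ^ 2 * (s ^ 2) ^ (2 * k + 1) ≤ ∑ i, w i * x i ^ (2 * k + 1) := by
    rw [ha, sq_abs]
    exact Finset.single_le_sum (f := fun i => w i * x i ^ (2 * k + 1))
      (fun i _ => by positivity) (Finset.mem_univ (⟨0, hm⟩ : Fin m))
  have hpos : 0 < a ^ 2 * (s ^ 2) ^ (2 * k + 1) := by positivity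
  have hmom := rpow_le_moment_ratio w x (fun i => sq_nonneg _) hw1 (fun i => sq_nonneg _)
    (p := 2 * k + 1) (by omega) (hpos.trans_le hle)
  -- This is ρ ≥ σ₁ a^(1/p) with p = 2k+1: the top term alone bounds moment p from below by
  -- a²σ₁^(2p), and its p-th root bounds ρ².
  have hexp : s * Real.exp (Real.log a / (2 * k + 1)) ≤ ritzValue G v₀ (k + 1) := by
    refine le_of_sq_le_sq ?_ hR0
    rw [hsq]
    refine le_trans ?_ ((Real.rpow_le_rpow hpos.le hle (by positivity)).trans hmom)
    rw [Real.mul_rpow (by positivity) (by positivity), mul_pow, mul_comm]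
    refine le_of_eq ?_
    congr 1
    · rw [← Real.exp_log ha0, ← Real.exp_nat_mul, ← Real.exp_nat_mul, ← Real.exp_mul,
        Real.log_exp]
      congr 1
      push_cast
      ring
    · rw [← Real.rpow_natCast (s ^ 2), ← Real.rpow_mul (by positivity), mul_one_div_cancel,
        Real.rpow_one]
      positivity
  have h1 := Real.add_one_le_exp (Real.log a / (2 * k + 1))
  have h2 := mul_le_mul_of_nonneg_left h1 hs0.le
  rw [neg_div]
  linarith

/-- An error bound for the power method in terms of the spectral gap. -/
theorem spectralNorm_sub_ritzValue_le_gap (G : Fin N → Mat d m) (hm : 0 < m)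
    {b : OrthonormalBasis (Fin m) ℝ (Vec m)}
    (hb : ∀ i, Matrix.toEuclideanLin (∑ j, G j).transpose
      (Matrix.toEuclideanLin (∑ j, G j) (b i)) = (singVal (∑ j, G j) i) ^ 2 • b i)
    {v₀ : Vec m} (h : ‖v₀‖ = 1) (k : ℕ) {β : ℝ} (hβ : 0 < β)
    (hgap : singVal (∑ j, G j) 1 ≤ β * singVal (∑ j, G j) 0) :
    spectralNorm (∑ j, G j) - ritzValue G v₀ (k + 1) ≤
      spectralNorm (∑ j, G j) * (1 - |inner ℝ (b ⟨0, hm⟩) v₀| /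
        √(|inner ℝ (b ⟨0, hm⟩) v₀| ^ 2 + (β ^ (2 * k + 1)) ^ 2)) := by
  have hR0 := ritzValue_succ_nonneg G h k
  have hsq := ritzValue_sq G hb h k
  rw [spectralNorm_eq_singVal _ hm]
  set A := ∑ j, G j
  set s := singVal A 0 with hs
  set a := |inner ℝ (b ⟨0, hm⟩) v₀| with ha
  have ha0 : 0 ≤ a := abs_nonneg _
  rcases (singVal_nonneg A 0).eq_or_lt with hs0 | hs0
  · rw [hs, ← hs0]
    simpa using hR0
  set w : Fin m → ℝ := fun i => inner ℝ (b i) v₀ ^ 2 with hw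
  have hw1 : ∑ i, w i = 1 := by
    have := b.sum_sq_norm_inner_right v₀
    simpa [h, sq_abs] using this
  have hw0 : w ⟨0, hm⟩ = a ^ 2 := by simp [hw, ha, sq_abs]
  have hnum : a ^ 2 * (s ^ 2) ^ (2 * k + 2) ≤
      ∑ i : Fin m, w i * (singVal A i ^ 2) ^ (2 * k + 2) := by
    rw [← hw0]
    exact Finset.single_le_sum (f := fun i : Fin m => w i * (singVal A i ^ 2) ^ (2 * k + 2))
      (fun i _ => by positivity) (Finset.mem_univ (⟨0, hm⟩ : Fin m))
  -- All singular values but the first are at most βσ₁, and their weights sum to at most 1.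
  have hden : ∑ i : Fin m, w i * (singVal A i ^ 2) ^ (2 * k + 1) ≤
      (a ^ 2 + (β ^ (2 * k + 1)) ^ 2) * (s ^ 2) ^ (2 * k + 1) := by
    rw [← Finset.add_sum_erase _ _ (Finset.mem_univ (⟨0, hm⟩ : Fin m)), hw0, add_mul]
    refine add_le_add le_rfl ?_
    calc ∑ i ∈ Finset.univ.erase (⟨0, hm⟩ : Fin m), w i * (singVal A i ^ 2) ^ (2 * k + 1)
        ≤ ∑ i ∈ Finset.univ.erase (⟨0, hm⟩ : Fin m), w i * ((β * s) ^ 2) ^ (2 * k + 1) := by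
          refine Finset.sum_le_sum fun i hi => ?_
          have hi1 : 1 ≤ (i : ℕ) := Nat.one_le_iff_ne_zero.2 fun h0 =>
            (Finset.mem_erase.1 hi).1 (Fin.ext h0)
          have := (singVal_antitone A hi1).trans hgap
          have := singVal_nonneg A i
          gcongr
      _ ≤ ∑ i, w i * ((β * s) ^ 2) ^ (2 * k + 1) :=
          Finset.sum_le_univ_sum_of_nonneg fun i => by positivity
      _ = (β ^ (2 * k + 1)) ^ 2 * (s ^ 2) ^ (2 * k + 1) := by
          rw [← Finset.sum_mul, hw1]
          ring
  have hexp : s * (a / √(a ^ 2 + (β ^ (2 * k + 1)) ^ 2)) ≤ ritzValue G v₀ (k + 1) := by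
    refine le_of_sq_le_sq ?_ hR0
    rcases ha0.eq_or_lt with ha1 | ha1
    · rw [← ha1]
      simpa using sq_nonneg (ritzValue G v₀ (k + 1))
    rw [hsq, mul_pow, div_pow, Real.sq_sqrt (by positivity)]
    have hle : a ^ 2 * (s ^ 2) ^ (2 * k + 1) ≤
        ∑ i : Fin m, w i * (singVal A i ^ 2) ^ (2 * k + 1) := by
      rw [← hw0]
      exact Finset.single_le_sum (f := fun i : Fin m => w i * (singVal A i ^ 2) ^ (2 * k + 1))
        (fun i _ => by positivity) (Finset.mem_univ (⟨0, hm⟩ : Fin m))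
    have hpos : 0 < a ^ 2 * (s ^ 2) ^ (2 * k + 1) := by positivity
    calc s ^ 2 * (a ^ 2 / (a ^ 2 + (β ^ (2 * k + 1)) ^ 2))
        = a ^ 2 * (s ^ 2) ^ (2 * k + 2) /
            ((a ^ 2 + (β ^ (2 * k + 1)) ^ 2) * (s ^ 2) ^ (2 * k + 1)) := by
          have hs1 : s ≠ 0 := hs0.ne'
          rw [show (s ^ 2) ^ (2 * k + 2) = s ^ 2 * (s ^ 2) ^ (2 * k + 1) by ring]
          field_simp
      _ ≤ _ := div_le_div₀ (Finset.sum_nonneg fun i _ => by positivity) hnum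
          (hpos.trans_le hle) hden
  linarith [hexp, mul_sub s 1 (a / √(a ^ 2 + (β ^ (2 * k + 1)) ^ 2))]

end PowerMethod

/-! ### The uniform distribution on the sphere -/

section Sphere

open scoped Pointwise

variable {m : ℕ}

theorem nontrivial_vec (hm : 0 < m) : Nontrivial (Vec m) := by
  have : Nonempty (Fin m) := ⟨⟨0, hm⟩⟩
  infer_instance

theorem isProbabilityMeasure_uniformSphere (hm : 0 < m) :
    IsProbabilityMeasure (uniformSphere m) := by
  have := nontrivial_vec hm
  refine ⟨?_⟩
  rw [uniformSphere, Measure.smul_apply, smul_eq_mul]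
  exact ENNReal.inv_mul_cancel (Measure.measure_univ_ne_zero.2 (Measure.toSphere_ne_zero _))
    (measure_ne_top _ _)

/-- After squaring, this is Bernoulli's inequality (1 - 1/m)^(m-1) ≥ 1/m. It bounds from below the
determinant in the slab estimate. -/
theorem inv_le_mul_sqrt_pow (hm : 0 < m) :
    (m : ℝ)⁻¹ ≤ √(1 / m) * √(1 - 1 / m) ^ (m - 1) := by
  have hm' : (1 : ℝ) ≤ m := by exact_mod_cast hm
  have h1 : (1 : ℝ) / m ≤ 1 := by rw [div_le_one (by positivity)]; exact hm'
  have h0 : (0 : ℝ) ≤ 1 / m := by positivity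
  refine le_of_sq_le_sq ?_ (by positivity)
  rw [mul_pow, Real.sq_sqrt h0, ← pow_mul, mul_comm (m - 1), pow_mul, Real.sq_sqrt (by linarith)]
  have hB := one_add_mul_le_pow (a := -(1 / (m : ℝ))) (by linarith) (m - 1)
  rw [Nat.cast_sub hm, Nat.cast_one] at hB
  calc ((m : ℝ)⁻¹) ^ 2 = 1 / m * (1 + ((m : ℝ) - 1) * -(1 / (m : ℝ))) := by field_simp; ring
    _ ≤ 1 / m * (1 + -(1 / (m : ℝ))) ^ (m - 1) := by gcongr
    _ = _ := by rw [← sub_eq_add_neg]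

/-- The part of the unit ball in a slab of half-width `s` around a hyperplane. -/
theorem volume_slab_le (b : OrthonormalBasis (Fin m) ℝ (Vec m)) (i₀ : Fin m) {s : ℝ}
    (hs : 0 < s) :
    volume {x : Vec m | ‖x‖ ≤ 1 ∧ |inner ℝ (b i₀) x| ≤ s} ≤
      ENNReal.ofReal (m * s) * volume (Metric.ball (0 : Vec m) 1) := by
  have hm : 0 < m := i₀.pos
  have hm' : (1 : ℝ) ≤ m := by exact_mod_cast hm
  have h1 : (1 : ℝ) / m ≤ 1 := by rw [div_le_one (by positivity)]; exact hm'
  set S := {x : Vec m | ‖x‖ ≤ 1 ∧ |inner ℝ (b i₀) x| ≤ s}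
  -- The slab direction is scaled so that |x| ≤ s contributes at most 1/m to the squared norm; the
  -- others are shrunk to contribute at most 1 - 1/m. The slab is thus mapped into the unit ball by
  -- a map of determinant at least 1/(ms).
  set w : Fin m → ℝ := fun i => if i = i₀ then √(1 / m) / s else √(1 - 1 / m) with hw
  set T := Matrix.toLin b.toBasis b.toBasis (Matrix.diagonal w) with hT
  have hdet : LinearMap.det T = √(1 / m) / s * √(1 - 1 / m) ^ (m - 1) := by
    rw [hT, LinearMap.det_toLin, Matrix.det_diagonal,
      ← Finset.mul_prod_erase _ _ (Finset.mem_univ i₀)]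
    congr 1
    · simp [hw]
    · rw [Finset.prod_congr rfl (g := fun _ => √(1 - 1 / (m : ℝ)))]
      · simp [Finset.card_erase_of_mem]
      · intro i hi
        simp [hw, (Finset.mem_erase.1 hi).1]
  have hrepr : ∀ x i, inner ℝ (b i) (T x) = w i * inner ℝ (b i) x := by
    intro x i
    have h := congrFun (Matrix.repr_toLin b.toBasis b.toBasis (Matrix.diagonal w) x) i
    simpa [Matrix.mulVec_diagonal, OrthonormalBasis.repr_apply_apply] using h
  have himg : T '' S ⊆ Metric.closedBall 0 1 := by
    rintro _ ⟨x, ⟨hx1, hx2⟩, rfl⟩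
    rw [mem_closedBall_zero_iff]
    refine le_of_sq_le_sq ?_ zero_le_one
    rw [← b.sum_sq_norm_inner_right]
    have hx1' : ‖x‖ ^ 2 ≤ 1 := pow_le_one₀ (norm_nonneg _) hx1
    rw [← b.sum_sq_norm_inner_right] at hx1'
    have hx2' : inner ℝ (b i₀) x ^ 2 ≤ s ^ 2 := sq_le_sq' (abs_le.1 hx2).1 (abs_le.1 hx2).2
    calc ∑ i, ‖inner ℝ (b i) (T x)‖ ^ 2
        ≤ ∑ i, ((if i = i₀ then 1 / (m : ℝ) else 0) +
            (1 - 1 / m) * ‖inner ℝ (b i) x‖ ^ 2) := by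
          refine Finset.sum_le_sum fun i _ => ?_
          rw [hrepr, Real.norm_eq_abs, sq_abs, mul_pow, Real.norm_eq_abs, sq_abs, hw]
          rcases eq_or_ne i i₀ with rfl | hi
          · simp only [if_true]
            rw [div_pow, Real.sq_sqrt (by positivity), div_mul_eq_mul_div]
            have : 1 / (m : ℝ) * inner ℝ (b i) x ^ 2 / s ^ 2 ≤ 1 / m := by
              rw [div_le_iff₀ (by positivity)]
              gcongr
            have h2 : 0 ≤ (1 - 1 / (m : ℝ)) * inner ℝ (b i) x ^ 2 :=
              mul_nonneg (by linarith) (sq_nonneg _)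
            linarith
          · simp only [if_neg hi]
            rw [Real.sq_sqrt (by linarith)]
            linarith
      _ = 1 / m + (1 - 1 / m) * ∑ i, ‖inner ℝ (b i) x‖ ^ 2 := by
          rw [Finset.sum_add_distrib, Finset.mul_sum]
          simp
      _ ≤ 1 / m + (1 - 1 / m) * 1 := by
          have : (0 : ℝ) ≤ 1 - 1 / m := by linarith
          gcongr
      _ = 1 ^ 2 := by ring
  have := nontrivial_vec hm
  have hvol := measure_mono (μ := volume) himg
  rw [Measure.addHaar_image_linearMap, Measure.addHaar_closedBall_eq_addHaar_ball, hdet] at hvol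
  calc volume S = 1 * volume S := (one_mul _).symm
    _ ≤ (ENNReal.ofReal (m * s) *
          ENNReal.ofReal |√(1 / m) / s * √(1 - 1 / m) ^ (m - 1)|) * volume S := by
        gcongr
        rw [← ENNReal.ofReal_mul (by positivity), ← ENNReal.ofReal_one]
        refine ENNReal.ofReal_le_ofReal ?_
        rw [abs_of_nonneg (by positivity)]
        have h := inv_le_mul_sqrt_pow hm
        calc (1 : ℝ) = m * (m : ℝ)⁻¹ := by field_simp
          _ ≤ m * (√(1 / m) * √(1 - 1 / m) ^ (m - 1)) := by gcongr
          _ = _ := by field_simp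
    _ ≤ _ := by
        rw [mul_assoc]
        gcongr

/-- Small-ball estimate for one coordinate of a uniformly distributed unit vector. -/
theorem uniformSphere_abs_inner_le (b : OrthonormalBasis (Fin m) ℝ (Vec m)) (i₀ : Fin m) {s : ℝ}
    (hs : 0 < s) :
    uniformSphere m {v | |inner ℝ (b i₀) (v : Vec m)| ≤ s} ≤ ENNReal.ofReal (m * s) := by
  have hm : 0 < m := i₀.pos
  have := nontrivial_vec hm
  have hmeas : MeasurableSet {v : Metric.sphere (0 : Vec m) 1 |
      |inner ℝ (b i₀) (v : Vec m)| ≤ s} := by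
    refine measurableSet_le ?_ measurable_const
    exact (Continuous.measurable (by fun_prop))
  rw [uniformSphere, Measure.smul_apply, smul_eq_mul, Measure.toSphere_apply' _ hmeas]
  -- Surface measure is defined through the volume of the cone over a set; scaling by r < 1 keeps
  -- the cone inside the slab.
  have hsub : Set.Ioo (0 : ℝ) 1 • ((↑) '' {v : Metric.sphere (0 : Vec m) 1 |
      |inner ℝ (b i₀) (v : Vec m)| ≤ s}) ⊆
      {x : Vec m | ‖x‖ ≤ 1 ∧ |inner ℝ (b i₀) x| ≤ s} := by
    rintro _ ⟨r, hr, _, ⟨v, hv, rfl⟩, rfl⟩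
    have hv1 : ‖(v : Vec m)‖ = 1 := by simp
    have hr' : |r| ≤ 1 := by rw [abs_of_pos hr.1]; exact hr.2.le
    refine ⟨?_, ?_⟩
    · simpa [norm_smul, hv1] using hr'
    · simp only [real_inner_smul_right, abs_mul]
      exact (mul_le_of_le_one_left (abs_nonneg _) hr').trans hv
  have h := (measure_mono (μ := volume) hsub).trans (volume_slab_le b i₀ hs)
  have h2 : (Module.finrank ℝ (Vec m) : ENNReal) * volume (Set.Ioo (0 : ℝ) 1 •
      (Subtype.val '' {v : Metric.sphere (0 : Vec m) 1 | |inner ℝ (b i₀) (v : Vec m)| ≤ s})) ≤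
      ENNReal.ofReal (m * s) * (volume : Measure (Vec m)).toSphere Set.univ := by
    rw [Measure.toSphere_apply_univ, mul_left_comm]
    gcongr
  calc _ ≤ ((volume : Measure (Vec m)).toSphere Set.univ)⁻¹ *
        (ENNReal.ofReal (m * s) * (volume : Measure (Vec m)).toSphere Set.univ) := by gcongr
    _ = ENNReal.ofReal (m * s) := by
        rw [mul_left_comm, ENNReal.inv_mul_cancel
          (Measure.measure_univ_ne_zero.2 (Measure.toSphere_ne_zero _)) (measure_ne_top _ _), mul_one]

end Sphere

/-! ### From small-ball estimates to bounds on expectations -/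

section SmallBall

variable {Ω : Type*} [MeasurableSpace Ω] {P : Measure Ω} {X : Ω → ℝ} {A : ℝ}

theorem ae_pos_of_smallBall
    (h : ∀ s, 0 < s → P {ω | X ω ≤ s} ≤ ENNReal.ofReal (A * s)) : ∀ᵐ ω ∂P, 0 < X ω := by
  have hlim : Filter.Tendsto (fun s : ℝ => ENNReal.ofReal (A * s)) (nhdsWithin 0 (Set.Ioi 0))
      (nhds 0) := by
    have : Filter.Tendsto (fun s : ℝ => ENNReal.ofReal (A * s)) (nhds 0)
        (nhds (ENNReal.ofReal (A * 0))) :=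
      (ENNReal.continuous_ofReal.comp (continuous_const.mul continuous_id)).tendsto 0
    rw [mul_zero, ENNReal.ofReal_zero] at this
    exact this.mono_left nhdsWithin_le_nhds
  have hz : P {ω | X ω ≤ 0} ≤ 0 := by
    refine ge_of_tendsto hlim ?_
    filter_upwards [self_mem_nhdsWithin] with s hs
    exact (measure_mono fun ω (hω : X ω ≤ 0) => hω.trans (le_of_lt hs)).trans (h s hs)
  rw [ae_iff]
  simpa using hz

/-- A nonnegative random variable with `P(X ≤ s) ≤ A s` stochastically dominates the uniform
distribution on `[0, 1 / A]`. -/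
theorem lintegral_antitone_le_of_smallBall (hX : Measurable X) (hA : 0 < A)
    (h : ∀ s, 0 < s → P {ω | X ω ≤ s} ≤ ENNReal.ofReal (A * s))
    {g : ℝ → ℝ} (hgm : Measurable g) (hg0 : ∀ s, 0 < s → 0 ≤ g s)
    (hg : AntitoneOn g (Set.Ioi 0)) :
    ∫⁻ ω, ENNReal.ofReal (g (X ω)) ∂P ≤
      ENNReal.ofReal A * ∫⁻ s in Set.Ioi 0, ENNReal.ofReal (g s) := by
  have hpos := ae_pos_of_smallBall h
  -- Layer-cake formula on both sides, so that superlevel sets of `g` can be compared one level at a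
  -- time.
  rw [MeasureTheory.lintegral_eq_lintegral_meas_lt P (hpos.mono fun ω hω => hg0 _ hω)
      (hgm.comp hX).aemeasurable,
    MeasureTheory.lintegral_eq_lintegral_meas_lt (volume.restrict (Set.Ioi 0))
      ((ae_restrict_mem measurableSet_Ioi).mono fun s hs => hg0 s hs) hgm.aemeasurable,
    ← lintegral_const_mul' _ _ ENNReal.ofReal_ne_top]
  refine lintegral_mono fun y => ?_
  -- Since `g` is antitone, `U` is an interval starting at 0. Its length is sup U, and P(X ∈ U) ≤
  -- P(X ≤ sup U) ≤ A sup U.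
  set U : Set ℝ := {s | 0 < s ∧ y < g s} with hU
  have hvU : (volume.restrict (Set.Ioi 0)) {s | y < g s} = volume U := by
    rw [Measure.restrict_apply (measurableSet_lt measurable_const hgm)]
    congr 1
    ext s
    simp [hU, and_comm]
  have hsub : ∀ᵐ ω ∂P, y < g (X ω) → X ω ∈ U := hpos.mono fun ω hω hy => ⟨hω, hy⟩
  have hPU : P {ω | y < g (X ω)} ≤ P {ω | X ω ∈ U} := measure_mono_ae hsub
  have hlower : ∀ s ∈ U, Set.Ioo 0 s ⊆ U := fun s hs r hr =>
    ⟨hr.1, hs.2.trans_le (hg hr.1 hs.1 hr.2.le)⟩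
  rw [hvU]
  refine hPU.trans ?_
  rcases U.eq_empty_or_nonempty with hUe | ⟨s₀, hs₀⟩
  · simp [hUe]
  by_cases hb : BddAbove U
  · have hsup : 0 < sSup U := hs₀.1.trans_le (le_csSup hb hs₀)
    have hle : ENNReal.ofReal (sSup U) ≤ volume U := by
      refine le_of_eq_of_le (b := volume (Set.Ioo 0 (sSup U))) (by simp) (measure_mono ?_)
      intro r hr
      obtain ⟨s, hs, hrs⟩ := exists_lt_of_lt_csSup ⟨s₀, hs₀⟩ hr.2
      exact hlower s hs ⟨hr.1, hrs⟩
    refine (measure_mono fun ω (hω : X ω ∈ U) => le_csSup hb hω).trans ((h _ hsup).trans ?_)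
    rw [ENNReal.ofReal_mul hA.le]
    gcongr
  · have htop : volume U = ⊤ := by
      refine ENNReal.eq_top_of_forall_nnreal_le fun r => ?_
      obtain ⟨s, hs, hrs⟩ := not_bddAbove_iff.1 hb (r : ℝ)
      refine le_trans ?_ (measure_mono (hlower s hs))
      rw [Real.volume_Ioo, sub_zero, ← ENNReal.ofReal_coe_nnreal]
      exact ENNReal.ofReal_le_ofReal hrs.le
    rw [htop, ENNReal.mul_top (by simpa using hA)]
    exact le_top

end SmallBall

section SmallBallExpectation

variable {Ω : Type*} [MeasurableSpace Ω] {P : Measure Ω} {X : Ω → ℝ} {A : ℝ}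

/-- The integrand vanishes beyond 1/A, and on (0, 1/A] the integral is (1/A) times that of -log over
(0, 1]. -/
theorem setLIntegral_posPart_neg_log (hA : 0 < A) :
    ∫⁻ s in Set.Ioi 0, ENNReal.ofReal (max (-Real.log (A * s)) 0) = ENNReal.ofReal (1 / A) := by
  have hA' : 0 < 1 / A := by positivity
  have hsplit : ∫⁻ s in Set.Ioi 0, ENNReal.ofReal (max (-Real.log (A * s)) 0) =
      ∫⁻ s in Set.Ioc 0 (1 / A), ENNReal.ofReal (-Real.log (A * s)) := by
    rw [← lintegral_indicator measurableSet_Ioi, ← lintegral_indicator measurableSet_Ioc]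
    refine lintegral_congr fun s => ?_
    by_cases h0 : 0 < s
    · by_cases h1 : s ≤ 1 / A
      · have hl : 0 ≤ -Real.log (A * s) := by
          refine neg_nonneg.2 (Real.log_nonpos (by positivity) ?_)
          rwa [le_div_iff₀ hA, mul_comm] at h1
        rw [Set.indicator_of_mem (by exact h0), Set.indicator_of_mem (Set.mem_Ioc.2 ⟨h0, h1⟩), max_eq_left hl]
      · have hl : -Real.log (A * s) ≤ 0 := by
          refine neg_nonpos.2 (Real.log_nonneg ?_)
          rw [not_le, div_lt_iff₀ hA, mul_comm] at h1
          exact h1.le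
        rw [Set.indicator_of_mem (by exact h0), Set.indicator_of_notMem (fun h => h1 h.2),
          max_eq_right hl, ENNReal.ofReal_zero]
    · rw [Set.indicator_of_notMem (by exact h0), Set.indicator_of_notMem (fun h => h0 h.1)]
  have hint : IntervalIntegrable (fun s => -Real.log (A * s)) volume 0 (1 / A) := by
    have h := ((intervalIntegrable_const (c := Real.log A)).add
      (intervalIntegral.intervalIntegrable_log' (a := 0) (b := 1 / A))).neg
    refine h.congr_ae ?_
    rw [Set.uIoc_of_le hA'.le]
    filter_upwards [ae_restrict_mem measurableSet_Ioc] with s hs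
    simp [Real.log_mul hA.ne' hs.1.ne']
  rw [hsplit, ← ofReal_integral_eq_lintegral_ofReal]
  · rw [← intervalIntegral.integral_of_le hA'.le]
    congr 1
    have : ∫ s in (0)..(1 / A), -Real.log (A * s) =
        ∫ s in (0)..(1 / A), -(Real.log A + Real.log s) := by
      refine intervalIntegral.integral_congr_ae (Filter.Eventually.of_forall fun s hs => ?_)
      rw [Set.uIoc_of_le hA'.le] at hs
      rw [Real.log_mul hA.ne' hs.1.ne']
    rw [this, intervalIntegral.integral_neg, intervalIntegral.integral_add
      intervalIntegrable_const intervalIntegral.intervalIntegrable_log',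
      integral_log, intervalIntegral.integral_const]
    simp
  · exact (intervalIntegrable_iff_integrableOn_Ioc_of_le hA'.le).1 hint
  · filter_upwards [ae_restrict_mem measurableSet_Ioc] with s hs
    refine neg_nonneg.2 (Real.log_nonpos (mul_nonneg hA.le hs.1.le) ?_)
    have := hs.2
    rwa [le_div_iff₀ hA, mul_comm] at this

/-- Writing -log X = log A - log(AX) and keeping the positive part of the last term gives a
nonnegative antitone function, to which the comparison with the uniform law on [0, 1/A] applies.
That part contributes the 1. -/
theorem lintegral_neg_log_le_of_smallBall [IsProbabilityMeasure P] (hX : Measurable X)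
    (hA : 1 ≤ A) (h : ∀ s, 0 < s → P {ω | X ω ≤ s} ≤ ENNReal.ofReal (A * s)) :
    ∫⁻ ω, ENNReal.ofReal (-Real.log (X ω)) ∂P ≤ ENNReal.ofReal (Real.log A + 1) := by
  have hA0 : 0 < A := zero_lt_one.trans_le hA
  have hlogA := Real.log_nonneg hA
  have hb := lintegral_antitone_le_of_smallBall hX hA0 h
    (g := fun s => max (-Real.log (A * s)) 0) (by fun_prop) (fun s _ => le_max_right _ _)
    (fun s hs t ht hst => max_le_max (neg_le_neg (Real.log_le_log (mul_pos hA0 hs)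
      (mul_le_mul_of_nonneg_left hst hA0.le))) le_rfl)
  rw [setLIntegral_posPart_neg_log hA0, ← ENNReal.ofReal_mul hA0.le,
    mul_one_div_cancel hA0.ne'] at hb
  calc ∫⁻ ω, ENNReal.ofReal (-Real.log (X ω)) ∂P
      ≤ ∫⁻ ω, (ENNReal.ofReal (Real.log A) + ENNReal.ofReal (max (-Real.log (A * X ω)) 0)) ∂P := by
        refine lintegral_mono_ae ((ae_pos_of_smallBall h).mono fun ω hω => ?_)
        rw [← ENNReal.ofReal_add hlogA (le_max_right _ _)]
        refine ENNReal.ofReal_le_ofReal ?_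
        have := le_max_left (-Real.log (A * X ω)) 0
        rw [Real.log_mul hA0.ne' hω.ne'] at this ⊢
        linarith
    _ = ENNReal.ofReal (Real.log A) +
          ∫⁻ ω, ENNReal.ofReal (max (-Real.log (A * X ω)) 0) ∂P := by
        rw [lintegral_add_left measurable_const, lintegral_const, measure_univ, mul_one]
    _ ≤ ENNReal.ofReal (Real.log A) + ENNReal.ofReal 1 := by gcongr
    _ = _ := (ENNReal.ofReal_add hlogA zero_le_one).symm

theorem one_sub_div_sqrt_nonneg (s ε : ℝ) : 0 ≤ 1 - s / √(s ^ 2 + ε ^ 2) := by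
  rw [sub_nonneg]
  refine div_le_one_of_le₀ (Real.le_sqrt_of_sq_le ?_) (Real.sqrt_nonneg _)
  linarith [sq_nonneg ε]

theorem div_sqrt_le_div_sqrt {s t ε : ℝ} (hs : 0 < s) (hst : s ≤ t) :
    s / √(s ^ 2 + ε ^ 2) ≤ t / √(t ^ 2 + ε ^ 2) := by
  have ht : 0 < t := hs.trans_le hst
  rw [div_le_div_iff₀ (by positivity) (by positivity)]
  refine le_of_sq_le_sq ?_ (by positivity)
  rw [mul_pow, mul_pow, Real.sq_sqrt (by positivity), Real.sq_sqrt (by positivity)]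
  have : s ^ 2 ≤ t ^ 2 := by gcongr
  nlinarith [mul_le_mul_of_nonneg_right this (sq_nonneg ε)]

theorem lintegral_one_sub_div_sqrt_le_of_smallBall (hX : Measurable X) (hX1 : ∀ ω, X ω ≤ 1)
    (hA : 0 < A) (h : ∀ s, 0 < s → P {ω | X ω ≤ s} ≤ ENNReal.ofReal (A * s)) {ε : ℝ}
    (hε : 0 < ε) :
    ∫⁻ ω, ENNReal.ofReal (1 - X ω / √(X ω ^ 2 + ε ^ 2)) ∂P ≤ ENNReal.ofReal (A * ε) := by
  set g : ℝ → ℝ := fun s => 1 - s / √(s ^ 2 + ε ^ 2) with hg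
  have hgc : Continuous g := by
    refine continuous_const.sub (continuous_id.div (by fun_prop) fun s => ?_)
    positivity
  -- Cutting off at 1 changes nothing on the left, as X ≤ 1, and leaves a bounded interval on the
  -- right.
  have hb := lintegral_antitone_le_of_smallBall hX hA h
    (g := (Set.Iic 1).indicator g) (hgc.measurable.indicator measurableSet_Iic)
    (fun s _ => Set.indicator_apply_nonneg fun _ => one_sub_div_sqrt_nonneg _ _)
    (by
      intro s hs t ht hst
      by_cases h1 : t ≤ 1
      · rw [Set.indicator_of_mem (by exact h1), Set.indicator_of_mem (by exact hst.trans h1)]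
        exact sub_le_sub_left (div_sqrt_le_div_sqrt hs hst) 1
      · rw [Set.indicator_of_notMem (by exact h1)]
        exact Set.indicator_apply_nonneg fun _ => one_sub_div_sqrt_nonneg _ _)
  have hX' : ∀ ω, (Set.Iic 1).indicator g (X ω) = g (X ω) := fun ω =>
    Set.indicator_of_mem (Set.mem_Iic.2 (hX1 ω)) _
  simp only [hX'] at hb
  refine hb.trans ?_
  rw [ENNReal.ofReal_mul hA.le]
  gcongr
  have hsplit : ∫⁻ s in Set.Ioi 0, ENNReal.ofReal ((Set.Iic 1).indicator g s) =
      ∫⁻ s in Set.Ioc 0 1, ENNReal.ofReal (g s) := by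
    rw [← Set.Ioi_inter_Iic, Set.inter_comm, ← setLIntegral_indicator measurableSet_Iic]
    refine lintegral_congr fun s => ?_
    by_cases h1 : s ∈ Set.Iic (1 : ℝ) <;> simp [Set.indicator, h1]
  rw [hsplit, ← ofReal_integral_eq_lintegral_ofReal
    ((intervalIntegrable_iff_integrableOn_Ioc_of_le zero_le_one).1 (hgc.intervalIntegrable 0 1))
    ((ae_restrict_mem measurableSet_Ioc).mono fun s _ => one_sub_div_sqrt_nonneg _ _),
    ← intervalIntegral.integral_of_le zero_le_one]
  refine ENNReal.ofReal_le_ofReal ?_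
  -- The antiderivative s - √(s² + ε²) gives the integral 1 - √(1 + ε²) + ε, which is at most ε.
  have hderiv : ∀ s ∈ Set.uIcc (0 : ℝ) 1,
      HasDerivAt (fun s => s - √(s ^ 2 + ε ^ 2)) (g s) s := by
    intro s _
    have h1 : HasDerivAt (fun s : ℝ => s ^ 2 + ε ^ 2) (2 * s) s := by
      simpa using (hasDerivAt_pow 2 s).add_const (ε ^ 2)
    have h2 := (hasDerivAt_id s).sub (h1.sqrt (by positivity))
    refine h2.congr_deriv ?_
    rw [hg]
    field_simp
  rw [intervalIntegral.integral_eq_sub_of_hasDerivAt hderiv (hgc.intervalIntegrable 0 1)]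
  have h1 : (1 : ℝ) ≤ √(1 ^ 2 + ε ^ 2) := Real.le_sqrt_of_sq_le (by linarith [sq_nonneg ε])
  have h0 : √((0 : ℝ) ^ 2 + ε ^ 2) = ε := by simp [Real.sqrt_sq hε.le]
  rw [h0]
  linarith

end SmallBallExpectation

/-! ### Expected error of the power method from a uniform start -/

section ExpectedRitzValue

variable {d m N : ℕ}

theorem measurable_abs_inner_sphere (x : Vec m) :
    Measurable fun v : Metric.sphere (0 : Vec m) 1 => |inner ℝ x (v : Vec m)| :=
  Continuous.measurable (by fun_prop)

theorem norm_coe_sphere (v : Metric.sphere (0 : Vec m) 1) : ‖(v : Vec m)‖ = 1 := by simp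

/-- Gap-free bound on the expected error of the power method from a uniform start. -/
theorem lintegral_spectralNorm_sub_ritzValue_le_log (hm : 0 < m) (G : Fin N → Mat d m) (k : ℕ) :
    ∫⁻ v, ENNReal.ofReal (spectralNorm (∑ j, G j) - ritzValue G (v : Vec m) (k + 1))
        ∂uniformSphere m ≤
      ENNReal.ofReal (spectralNorm (∑ j, G j) * ((Real.log m + 1) / (2 * k + 1))) := by
  have := isProbabilityMeasure_uniformSphere hm
  obtain ⟨b, hb⟩ := exists_rightSingularBasis (∑ j, G j)
  have hsb := fun s (hs : 0 < s) => uniformSphere_abs_inner_le b ⟨0, hm⟩ hs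
  have hlog := lintegral_neg_log_le_of_smallBall (measurable_abs_inner_sphere (b ⟨0, hm⟩))
    (by exact_mod_cast hm) hsb
  have hc : 0 ≤ spectralNorm (∑ j, G j) / (2 * (k : ℝ) + 1) :=
    div_nonneg (spectralNorm_nonneg _) (by positivity)
  calc _ ≤ ∫⁻ v, ENNReal.ofReal (spectralNorm (∑ j, G j) / (2 * (k : ℝ) + 1)) *
          ENNReal.ofReal (-Real.log |inner ℝ (b ⟨0, hm⟩) (v : Vec m)|) ∂uniformSphere m := by
        refine lintegral_mono_ae ((ae_pos_of_smallBall hsb).mono fun v hv => ?_)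
        rw [← ENNReal.ofReal_mul hc]
        refine ENNReal.ofReal_le_ofReal ((spectralNorm_sub_ritzValue_le_log G hm hb
          (norm_coe_sphere v) k (abs_pos.1 hv)).trans (le_of_eq (by ring)))
    _ ≤ ENNReal.ofReal (spectralNorm (∑ j, G j) / (2 * (k : ℝ) + 1)) *
          ENNReal.ofReal (Real.log m + 1) := by
        rw [lintegral_const_mul' _ _ ENNReal.ofReal_ne_top]
        gcongr
    _ = _ := by
        rw [← ENNReal.ofReal_mul hc]
        congr 1
        ring

/-- Bound on the expected error of the power method from a uniform start under a spectral gap. -/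
theorem lintegral_spectralNorm_sub_ritzValue_le_gap (hm : 0 < m) (G : Fin N → Mat d m) (k : ℕ)
    {β : ℝ} (hβ : 0 < β) (hgap : singVal (∑ j, G j) 1 ≤ β * singVal (∑ j, G j) 0) :
    ∫⁻ v, ENNReal.ofReal (spectralNorm (∑ j, G j) - ritzValue G (v : Vec m) (k + 1))
        ∂uniformSphere m ≤
      ENNReal.ofReal (spectralNorm (∑ j, G j) * (m * β ^ (2 * k + 1))) := by
  have := isProbabilityMeasure_uniformSphere hm
  obtain ⟨b, hb⟩ := exists_rightSingularBasis (∑ j, G j)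
  have hsb := fun s (hs : 0 < s) => uniformSphere_abs_inner_le b ⟨0, hm⟩ hs
  have hle1 : ∀ v : Metric.sphere (0 : Vec m) 1, |inner ℝ (b ⟨0, hm⟩) (v : Vec m)| ≤ 1 := by
    intro v
    simpa using abs_real_inner_le_norm (b ⟨0, hm⟩) (v : Vec m)
  have hbound := lintegral_one_sub_div_sqrt_le_of_smallBall
    (measurable_abs_inner_sphere (b ⟨0, hm⟩)) hle1 (by exact_mod_cast hm) hsb
    (pow_pos hβ (2 * k + 1))
  calc _ ≤ ∫⁻ v, ENNReal.ofReal (spectralNorm (∑ j, G j)) *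
          ENNReal.ofReal (1 - |inner ℝ (b ⟨0, hm⟩) (v : Vec m)| /
            √(|inner ℝ (b ⟨0, hm⟩) (v : Vec m)| ^ 2 + (β ^ (2 * k + 1)) ^ 2))
          ∂uniformSphere m := by
        refine lintegral_mono fun v => ?_
        rw [← ENNReal.ofReal_mul (spectralNorm_nonneg _)]
        exact ENNReal.ofReal_le_ofReal (spectralNorm_sub_ritzValue_le_gap G hm hb
          (norm_coe_sphere v) k hβ hgap)
    _ ≤ ENNReal.ofReal (spectralNorm (∑ j, G j)) * ENNReal.ofReal (m * β ^ (2 * k + 1)) := by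
        rw [lintegral_const_mul' _ _ ENNReal.ofReal_ne_top]
        gcongr
    _ = _ := (ENNReal.ofReal_mul (spectralNorm_nonneg _)).symm

end ExpectedRitzValue

/-! ### Gradients and the Frank-Wolfe step -/

section Gradient

variable {d m n N : ℕ}

theorem frobInner_eq_sum (A B : Mat d m) : frobInner A B = ∑ i, ∑ j, A i j * B i j := by
  simp only [frobInner, Matrix.trace, Matrix.diag_apply, Matrix.mul_apply, Matrix.transpose_apply]
  exact Finset.sum_comm

theorem frobInner_grad (f : Mat d m → ℝ) (W Z : Mat d m) :
    frobInner Z (grad f W) = fderiv ℝ f W Z := by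
  conv_rhs => rw [Matrix.matrix_eq_sum_single Z]
  rw [frobInner_eq_sum, map_sum]
  refine Finset.sum_congr rfl fun i _ => ?_
  rw [map_sum]
  refine Finset.sum_congr rfl fun j _ => ?_
  have : Matrix.single i j (Z i j) = Z i j • Matrix.single i j (1 : ℝ) := by simp
  rw [this, map_smul]
  rfl

theorem differentiableAt_objective {f : Fin n → Mat d m → ℝ} {W : Mat d m}
    (h : ∀ i, DifferentiableAt ℝ (f i) W) : DifferentiableAt ℝ (objective f) W :=
  DifferentiableAt.fun_sum fun i _ => h i

theorem sum_localGrad {f : Fin n → Mat d m → ℝ} (owner : Fin n → Fin N) {W : Mat d m}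
    (h : ∀ i, DifferentiableAt ℝ (f i) W) :
    ∑ j, localGrad f owner W j = grad (objective f) W := by
  simp only [localGrad]
  rw [Finset.sum_fiberwise]
  ext k l
  have : fderiv ℝ (objective f) W = ∑ i, fderiv ℝ (f i) W := by
    exact fderiv_fun_sum fun i _ => h i
  rw [grad, this, Matrix.sum_apply]
  simp [grad]

/-- One-sided limits are what is needed: from a boundary point of the ball, a segment towards a
feasible point may be feasible only for positive times. -/
theorem tendsto_directional {F : Mat d m → ℝ} {W : Mat d m} (h : DifferentiableAt ℝ F W)
    (Z : Mat d m) :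
    Filter.Tendsto (fun s : ℝ => s⁻¹ * (F (W + s • Z) - F W)) (nhdsWithin 0 (Set.Ioi 0))
      (nhds (fderiv ℝ F W Z)) := by
  have h1 := h.hasFDerivAt.hasLineDerivAt Z
  have := HasDerivAt.tendsto_slope_zero_right h1
  simp only [zero_add, zero_smul, add_zero, smul_eq_mul] at this
  exact this

theorem fderiv_le_of_convexOn {F : Mat d m → ℝ} {D : Set (Mat d m)} (hF : ConvexOn ℝ D F)
    {W Y : Mat d m} (hW : W ∈ D) (hY : Y ∈ D) (h : DifferentiableAt ℝ F W) :
    fderiv ℝ F W (Y - W) ≤ F Y - F W := by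
  refine le_of_tendsto (tendsto_directional h (Y - W)) ?_
  filter_upwards [Ioc_mem_nhdsGT (zero_lt_one (α := ℝ))] with s hs
  have h1 : F ((1 - s) • W + s • Y) ≤ (1 - s) • F W + s • F Y :=
    hF.2 hW hY (by linarith [hs.2]) hs.1.le (by ring)
  have h2 : (1 - s) • W + s • Y = W + s • (Y - W) := by
    rw [sub_smul, one_smul, smul_sub]
    abel
  rw [h2, smul_eq_mul, smul_eq_mul] at h1
  rw [inv_mul_le_iff₀ hs.1]
  linarith

/-- A function that is Lipschitz for the trace norm on the trace-norm ball has gradients of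
bounded spectral norm, also on the boundary. -/
theorem spectralNorm_grad_le {F : Mat d m → ℝ} {μ L : ℝ} (hμ : 0 < μ)
    (hconv : Convex ℝ (traceBall d m μ))
    (hLip : ∀ X ∈ traceBall d m μ, ∀ Y ∈ traceBall d m μ, |F X - F Y| ≤ L * traceNorm (X - Y))
    {W : Mat d m} (hW : W ∈ traceBall d m μ) (h : DifferentiableAt ℝ F W) :
    spectralNorm (grad F W) ≤ max L 0 := by
  have key : ∀ (u : Vec d) (v : Vec m), ‖u‖ ≤ 1 → ‖v‖ ≤ 1 →
      inner ℝ u (Matrix.toEuclideanLin (grad F W) v) ≤ max L 0 := by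
    intro u v hu hv
    rw [← frobInner_vecMulVec, frobInner_grad]
    set Z : Mat d m := Matrix.vecMulVec (WithLp.ofLp u) (WithLp.ofLp v) with hZ
    -- At a boundary point the direction Z itself may be infeasible. It is obtained, up to μ, as the
    -- difference of the feasible directions towards μZ and towards 0; the two moving points differ
    -- by the rank-one matrix sμZ.
    have h1 := (tendsto_directional h (μ • Z - W)).sub (tendsto_directional h (0 - W))
    rw [← map_sub] at h1
    have h2 : μ • Z - W - (0 - W) = μ • Z := by abel
    rw [h2, map_smul, smul_eq_mul] at h1
    have hZD : μ • Z ∈ traceBall d m μ :=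
      smul_vecMulVec_mem_traceBall hμ.le μ (abs_of_pos hμ).le hu hv
    have hseg : ∀ Y ∈ traceBall d m μ, ∀ s ∈ Set.Ioc (0 : ℝ) 1,
        W + s • (Y - W) ∈ traceBall d m μ := fun Y hY s hs =>
      hconv.add_smul_sub_mem hW hY ⟨hs.1.le, hs.2⟩
    have h3 : μ * fderiv ℝ F W Z ≤ μ * max L 0 := by
      refine le_of_tendsto h1 ?_
      filter_upwards [Ioc_mem_nhdsGT (zero_lt_one (α := ℝ))] with s hs
      have hl := (le_abs_self _).trans (hLip _ (hseg _ hZD s hs) _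
        (hseg 0 (zero_mem_traceBall hμ.le) s hs))
      have hdiff : W + s • (μ • Z - W) - (W + s • (0 - W)) =
          Matrix.vecMulVec (WithLp.ofLp ((s * μ) • u)) (WithLp.ofLp v) := by
        rw [WithLp.ofLp_smul, Matrix.smul_vecMulVec, ← hZ, smul_sub, smul_sub, smul_smul]
        simp
      have htn : traceNorm (W + s • (μ • Z - W) - (W + s • (0 - W))) ≤ s * μ := by
        rw [hdiff]
        refine (traceNorm_vecMulVec_le _ _).trans ?_
        have hsμ : 0 ≤ s * μ := mul_nonneg hs.1.le hμ.le
        rw [norm_smul, Real.norm_eq_abs, abs_of_nonneg hsμ]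
        calc s * μ * ‖u‖ * ‖v‖ ≤ s * μ * 1 * 1 := by gcongr
          _ = s * μ := by ring
      have hb : L * traceNorm (W + s • (μ • Z - W) - (W + s • (0 - W))) ≤
          max L 0 * (s * μ) :=
        mul_le_mul (le_max_left _ _) htn (traceNorm_nonneg _) (le_max_right _ _)
      rw [← mul_sub, inv_mul_le_iff₀ hs.1]
      linarith
    exact le_of_mul_le_mul_left h3 hμ
  refine ContinuousLinearMap.opNorm_le_of_unit_norm (le_max_right _ _) fun v hv => ?_
  rw [euclideanCLM_apply]
  set y := Matrix.toEuclideanLin (grad F W) v with hy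
  rcases eq_or_ne y 0 with h0 | h0
  · rw [h0, norm_zero]
    exact le_max_right _ _
  have h1 := key (NormedSpace.normalize y) v (norm_normalize_le y) hv.le
  rw [← hy, NormedSpace.normalize, real_inner_smul_left, real_inner_self_eq_norm_sq] at h1
  have : ‖y‖ ≠ 0 := norm_ne_zero_iff.2 h0
  rwa [sq, inv_mul_cancel_left₀ this] at h1

theorem subproblemSol_mem {μ : ℝ} (hμ : 0 ≤ μ) (G : Fin N → Mat d m) {v₀ : Vec m} (h : ‖v₀‖ ≤ 1)
    (K : ℕ) : subproblemSol μ G v₀ K ∈ traceBall d m μ := by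
  rw [subproblemSol, ← neg_smul]
  exact smul_vecMulVec_mem_traceBall hμ (-μ) (by rw [abs_neg, abs_of_nonneg hμ])
    (norm_powerMethod_fst_le G v₀ K) (norm_powerMethod_snd_le G h K)

theorem frobInner_subproblemSol (μ : ℝ) (G : Fin N → Mat d m) (v₀ : Vec m) (K : ℕ) :
    frobInner (subproblemSol μ G v₀ K) (∑ j, G j) = -(μ * ritzValue G v₀ K) := by
  rw [subproblemSol, frobInner_neg_left, frobInner_smul_left, frobInner_vecMulVec, ritzValue]

/-- Quadratic upper bound provided by the curvature constant. -/
theorem le_of_curvature {F : Mat d m → ℝ} {μ : ℝ} (hbdd : BddAbove (curvatureSet F μ))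
    {W S : Mat d m} (hW : W ∈ traceBall d m μ) (hS : S ∈ traceBall d m μ) {γ : ℝ}
    (hγ : γ ∈ Set.Ioc (0 : ℝ) 1) :
    F ((1 - γ) • W + γ • S) ≤
      F W + γ * frobInner (S - W) (grad F W) + γ ^ 2 / 2 * curvature F μ := by
  have h := le_csSup hbdd ⟨W, hW, S, hS, γ, hγ, rfl⟩
  rw [← curvature, add_sub_cancel_left, frobInner_smul_left] at h
  have h2 : (1 - γ) • W + γ • S = W + γ • (S - W) := by
    rw [sub_smul, one_smul, smul_sub]
    abel
  have hγ0 : 0 < γ := hγ.1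
  have h3 := mul_le_mul_of_nonneg_left h (by positivity : 0 ≤ γ ^ 2 / 2)
  rw [← mul_assoc, show γ ^ 2 / 2 * (2 / γ ^ 2) = 1 by field_simp, one_mul] at h3
  rw [h2]
  linarith

theorem two_div_add_two_mem (t : ℕ) : 2 / ((t : ℝ) + 2) ∈ Set.Ioc (0 : ℝ) 1 := by
  refine ⟨by positivity, ?_⟩
  rw [div_le_one (by positivity)]
  linarith [Nat.cast_nonneg (α := ℝ) t]

/-- Progress of one Frank-Wolfe step with an approximate solution of the linear subproblem. -/
theorem frankWolfe_step {f : Fin n → Mat d m → ℝ} {owner : Fin n → Fin N} {μ : ℝ} (hμ : 0 < μ)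
    (hdiff : ∀ i, ∀ W ∈ traceBall d m μ, DifferentiableAt ℝ (f i) W)
    (hconv : ConvexOn ℝ (traceBall d m μ) (objective f))
    (hbdd : BddAbove (curvatureSet (objective f) μ))
    {Wstar : Mat d m} (hWstar : Wstar ∈ traceBall d m μ)
    {γ : ℕ → Mat d m → Mat d m → ℝ} (hγ : IsStepSizeRule (objective f) μ γ)
    {W : Mat d m} (hW : W ∈ traceBall d m μ) {v₀ : Vec m} (hv : ‖v₀‖ ≤ 1) (K t : ℕ)
    {S : Mat d m} (hS : S = subproblemSol μ (localGrad f owner W) v₀ K) :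
    objective f ((1 - γ t W S) • W + γ t W S • S) ≤
      objective f W + 2 / ((t : ℝ) + 2) * (objective f Wstar - objective f W) +
        2 / ((t : ℝ) + 2) * (μ * (spectralNorm (∑ j, localGrad f owner W j) -
          ritzValue (localGrad f owner W) v₀ K)) +
        (2 / ((t : ℝ) + 2)) ^ 2 / 2 * curvature (objective f) μ := by
  have hSD : S ∈ traceBall d m μ := hS ▸ subproblemSol_mem hμ.le _ hv K
  set g := 2 / ((t : ℝ) + 2) with hg
  have hgm : g ∈ Set.Ioc (0 : ℝ) 1 := two_div_add_two_mem t
  -- Line search competes with the default step g, so the analysis can always use g.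
  have h1 : objective f ((1 - γ t W S) • W + γ t W S • S) ≤
      objective f ((1 - g) • W + g • S) := by
    rcases hγ.step t W hW S hSD with h | h
    · rw [h]
    · exact h.2 g ⟨hgm.1.le, hgm.2⟩
  have h2 := le_of_curvature hbdd hW hSD hgm
  have hsum := sum_localGrad owner fun i => hdiff i W hW
  have hlin := frobInner_subproblemSol μ (localGrad f owner W) v₀ K
  rw [← hS, hsum] at hlin
  have hcx := fderiv_le_of_convexOn hconv hW hWstar
    (differentiableAt_objective fun i => hdiff i W hW)
  rw [← frobInner_grad, frobInner_sub_left] at hcx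
  -- Duality gives ⟨W*, ∇F⟩ ≥ -μσ₁, while the computed S has ⟨S, ∇F⟩ = -μρ; the loss is μ(σ₁ - ρ).
  have hdual := (neg_le_abs _).trans (abs_frobInner_le Wstar (grad (objective f) W))
  have hdual2 := mul_le_mul_of_nonneg_right (show traceNorm Wstar ≤ μ from hWstar)
    (spectralNorm_nonneg (grad (objective f) W))
  rw [frobInner_sub_left, hlin] at h2
  rw [hsum]
  have h3 : g * (-(μ * ritzValue (localGrad f owner W) v₀ K) -
      frobInner W (grad (objective f) W)) ≤
      g * ((objective f Wstar - objective f W) + μ * (spectralNorm (grad (objective f) W) -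
        ritzValue (localGrad f owner W) v₀ K)) := by
    refine mul_le_mul_of_nonneg_left ?_ hgm.1.le
    linarith
  linarith

/-- Convexity of the ball enters as a hypothesis. It is part of the convexity of the objective on
the ball, so no triangle inequality for the trace norm is required. -/
theorem step_mem_traceBall {F : Mat d m → ℝ} {μ : ℝ} (hconv : Convex ℝ (traceBall d m μ))
    {γ : ℕ → Mat d m → Mat d m → ℝ} (hγ : IsStepSizeRule F μ γ) (t : ℕ)
    {W S : Mat d m} (hW : W ∈ traceBall d m μ) (hS : S ∈ traceBall d m μ) :
    (1 - γ t W S) • W + γ t W S • S ∈ traceBall d m μ := by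
  have hmem : γ t W S ∈ Set.Icc (0 : ℝ) 1 := by
    rcases hγ.step t W hW S hS with h | h
    · rw [h]
      exact Set.Ioc_subset_Icc_self (two_div_add_two_mem t)
    · exact h.1
  exact hconv hW hS (by linarith [hmem.2]) hmem.1 (by ring)

end Gradient

/-! ### Measurability of the iterates -/

section Measurability

variable {d m n N : ℕ}

instance : SecondCountableTopology (Mat d m) :=
  inferInstanceAs (SecondCountableTopology (Fin d → Fin m → ℝ))

/-- The Borel σ-algebra of the entrywise topology is that of the Frobenius norm. -/
instance : @BorelSpace (Mat d m)
    (Matrix.frobeniusNormedAddCommGroup (m := Fin d) (n := Fin m)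
      (α := ℝ)).toMetricSpace.toPseudoMetricSpace.toUniformSpace.toTopologicalSpace
    (instMeasurableSpaceMat d m) :=
  instBorelSpaceMat d m

/-- No regularity of `f` is required: `fderiv` is measurable even with its default value 0 at points
of non-differentiability. This matters because the fᵢ are arbitrary outside the ball. -/
theorem measurable_grad (f : Mat d m → ℝ) : Measurable (grad f) := by
  have hsum : grad f = fun W => ∑ i, ∑ j,
      Matrix.single i j (fderiv ℝ f W (Matrix.single i j 1)) := by
    funext W
    exact Matrix.matrix_eq_sum_single _
  rw [hsum]
  refine Finset.measurable_fun_sum _ fun i _ => Finset.measurable_fun_sum _ fun j _ => ?_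
  have hc : Continuous fun c : ℝ => (Matrix.single i j c : Mat d m) := by
    refine continuous_matrix fun k l => ?_
    simp only [Matrix.single_apply]
    split_ifs <;> fun_prop
  exact hc.measurable.comp (measurable_fderiv_apply_const ℝ f _)

theorem measurable_localGrad (f : Fin n → Mat d m → ℝ) (owner : Fin n → Fin N) (j : Fin N) :
    Measurable fun W => localGrad f owner W j :=
  Finset.measurable_fun_sum _ fun i _ => measurable_grad (f i)

theorem measurable_normalize {V : Type*} [NormedAddCommGroup V] [NormedSpace ℝ V]
    [MeasurableSpace V] [BorelSpace V] [SecondCountableTopology V] :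
    Measurable (NormedSpace.normalize : V → V) :=
  measurable_norm.inv.smul measurable_id

theorem measurable_toEuclideanLin_apply {α : Type*} [MeasurableSpace α] {A : α → Mat d m}
    {x : α → Vec m} (hA : Measurable A) (hx : Measurable x) :
    Measurable fun a => Matrix.toEuclideanLin (A a) (x a) := by
  have h : Measurable fun p : Mat d m × Vec m => Matrix.toEuclideanLin p.1 p.2 :=
    continuous_toEuclideanLin_apply.measurable
  have hp : Measurable fun a => (A a, x a) := hA.prodMk hx
  have h' := h.comp hp
  exact h'

theorem measurable_transpose : Measurable fun A : Mat d m => A.transpose :=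
  (Continuous.matrix_transpose continuous_id).measurable

variable {α : Type*} [MeasurableSpace α] {G : α → Fin N → Mat d m} {x : α → Vec m}

theorem measurable_powerMethod (hG : ∀ j, Measurable fun a => G a j) (hx : Measurable x) (k : ℕ) :
    Measurable fun a => powerMethod (G a) (x a) k := by
  induction k with
  | zero => exact measurable_const.prodMk hx
  | succ k ih =>
    have hu : Measurable fun a => NormedSpace.normalize
        (∑ j, Matrix.toEuclideanLin (G a j) (powerMethod (G a) (x a) k).2) :=
      measurable_normalize.comp (Finset.measurable_fun_sum _ fun j _ =>
        measurable_toEuclideanLin_apply (hG j) (measurable_snd.comp ih))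
    exact hu.prodMk (measurable_normalize.comp (Finset.measurable_fun_sum _ fun j _ =>
      measurable_toEuclideanLin_apply (measurable_transpose.comp (hG j)) hu))

theorem measurable_ritzValue (hG : ∀ j, Measurable fun a => G a j) (hx : Measurable x) (k : ℕ) :
    Measurable fun a => ritzValue (G a) (x a) k := by
  have h := measurable_powerMethod hG hx k
  exact (measurable_fst.comp h).inner (measurable_toEuclideanLin_apply
    (Finset.measurable_fun_sum _ fun j _ => hG j) (measurable_snd.comp h))

theorem measurable_subproblemSol (μ : ℝ) (hG : ∀ j, Measurable fun a => G a j) (hx : Measurable x)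
    (k : ℕ) : Measurable fun a => subproblemSol μ (G a) (x a) k := by
  have hc : Continuous fun p : Vec d × Vec m =>
      -(μ • Matrix.vecMulVec (WithLp.ofLp p.1) (WithLp.ofLp p.2)) := by
    refine Continuous.neg (Continuous.const_smul ?_ μ)
    exact Continuous.matrix_vecMulVec (by fun_prop) (by fun_prop)
  exact hc.measurable.comp (measurable_powerMethod hG hx k)

/-- A measurable function that agrees with `F` wherever `F` is differentiable. -/
theorem exists_measurable_eq_of_differentiableAt (F : Mat d m → ℝ) :
    ∃ F' : Mat d m → ℝ, Measurable F' ∧ ∀ W, DifferentiableAt ℝ F W → F' W = F W := by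
  classical
  refine ⟨Set.piecewise {W | DifferentiableAt ℝ F W} F fun _ => 0, ?_, fun W hW => ?_⟩
  · exact ContinuousOn.measurable_piecewise
      (fun W hW => (DifferentiableAt.continuousAt hW).continuousWithinAt) continuousOn_const
      (measurableSet_of_differentiableAt ℝ F)
  · exact Set.piecewise_eq_of_mem _ _ _ hW

/-- `F` may be non-measurable outside `D`, so it is replaced by a measurable function that agrees
with it along `X`. -/
theorem integrable_comp_of_mem {Ω : Type*} [MeasurableSpace Ω] {P : Measure Ω}
    [IsFiniteMeasure P] {F : Mat d m → ℝ} {D : Set (Mat d m)}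
    (hF : ∀ W ∈ D, DifferentiableAt ℝ F W) {B : ℝ} (hB : ∀ W ∈ D, |F W| ≤ B)
    {X : Ω → Mat d m} (hX : Measurable X) (hXD : ∀ ω, X ω ∈ D) :
    Integrable (fun ω => F (X ω)) P := by
  obtain ⟨F', hF'm, hF'⟩ := exists_measurable_eq_of_differentiableAt F
  have heq : (fun ω => F (X ω)) = fun ω => F' (X ω) := by
    funext ω
    rw [hF' _ (hF _ (hXD ω))]
  refine Integrable.of_bound (C := B) ?_ (Filter.Eventually.of_forall fun ω => hB _ (hXD ω))
  rw [heq]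
  exact (hF'm.comp hX).aestronglyMeasurable

end Measurability

/-! ### Independence of the current iterate and the fresh starting vector -/

section Independence

variable {Ω α β : Type*} [MeasurableSpace Ω] [MeasurableSpace α] [MeasurableSpace β]
  {P : Measure Ω}

theorem indepFun_of_recursion {X : ℕ → Ω → α} {v : ℕ → Ω → β} {Φ : ℕ → α × β → α}
    (hΦ : ∀ t, Measurable (Φ t)) (hv : ∀ t, Measurable (v t)) (hind : iIndepFun v P)
    {x₀ : α} (h0 : ∀ ω, X 0 ω = x₀) (hX : ∀ t ω, X (t + 1) ω = Φ t (X t ω, v t ω)) (t : ℕ) :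
    Measurable (X t) ∧ IndepFun (X t) (v t) P := by
  -- The strict past: at index t it is generated by v₀, …, v_{t-1}, hence is independent of v_t, and
  -- X_t is measurable for it.
  let ℱ : ℕ → MeasurableSpace Ω := fun t => ⨆ i ∈ Set.Iio t, MeasurableSpace.comap (v i) inferInstance
  have hmeas : ∀ t, Measurable[ℱ t] (X t) := by
    intro t
    induction t with
    | zero =>
      rw [funext h0]
      exact measurable_const
    | succ t ih =>
      rw [funext (hX t)]
      have hle : ℱ t ≤ ℱ (t + 1) :=
        biSup_mono fun i (hi : i < t) => hi.trans (Nat.lt_succ_self t)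
      have hvt : Measurable[ℱ (t + 1)] (v t) := by
        have h1 : MeasurableSpace.comap (v t) inferInstance ≤ ℱ (t + 1) :=
          le_biSup (fun i => MeasurableSpace.comap (v i) inferInstance)
            (show t ∈ Set.Iio (t + 1) from Nat.lt_succ_self t)
        exact (comap_measurable (v t)).mono h1 le_rfl
      exact (hΦ t).comp ((ih.mono hle le_rfl).prodMk hvt)
  have hℱ : ℱ t ≤ ‹MeasurableSpace Ω› := iSup₂_le fun i _ => (hv i).comap_le
  refine ⟨(hmeas t).mono hℱ le_rfl, ?_⟩
  have hi := indep_iSup_of_disjoint (fun i => (hv i).comap_le) hind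
    (S := Set.Iio t) (T := {t}) (by simp)
  rw [iSup_singleton] at hi
  exact indep_of_indep_of_le_left hi (hmeas t).comap_le

/-- Conditioning on an independent variable. -/
theorem lintegral_comp_indepFun_le [IsProbabilityMeasure P] {X : Ω → α} {v : Ω → β}
    (hX : Measurable X) (hv : Measurable v) (hind : IndepFun X v P) {Φ : α × β → ENNReal}
    (hΦ : Measurable Φ) {η : ENNReal}
    (h : ∀ᵐ ω ∂P, ∫⁻ y, Φ (X ω, y) ∂(P.map v) ≤ η) :
    ∫⁻ ω, Φ (X ω, v ω) ∂P ≤ η := by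
  have := Measure.isProbabilityMeasure_map (μ := P) hv.aemeasurable
  have hmap := (indepFun_iff_map_prod_eq_prod_map_map hX.aemeasurable hv.aemeasurable).1 hind
  calc ∫⁻ ω, Φ (X ω, v ω) ∂P = ∫⁻ p, Φ p ∂(P.map fun ω => (X ω, v ω)) :=
        (lintegral_map hΦ (hX.prodMk hv)).symm
    _ = ∫⁻ x, ∫⁻ y, Φ (x, y) ∂(P.map v) ∂(P.map X) := by
        rw [hmap, lintegral_prod _ hΦ.aemeasurable]
    _ = ∫⁻ ω, ∫⁻ y, Φ (X ω, y) ∂(P.map v) ∂P := lintegral_map hΦ.lintegral_prod_right' hX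
    _ ≤ ∫⁻ _, η ∂P := lintegral_mono_ae h
    _ = η := by simp

theorem integral_le_of_lintegral_le {f : Ω → ℝ} (hf : Integrable f P) {η : ℝ} (hη : 0 ≤ η)
    (h : ∫⁻ ω, ENNReal.ofReal (f ω) ∂P ≤ ENNReal.ofReal η) : ∫ ω, f ω ∂P ≤ η := by
  rw [integral_eq_lintegral_pos_part_sub_lintegral_neg_part hf]
  have h1 := ENNReal.toReal_mono ENNReal.ofReal_ne_top h
  rw [ENNReal.toReal_ofReal hη] at h1
  linarith [ENNReal.toReal_nonneg (a := ∫⁻ ω, ENNReal.ofReal (-f ω) ∂P)]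

end Independence

/-! ### Convergence -/

theorem frankWolfe_recursion {C : ℝ} (hC : 0 ≤ C) {a : ℕ → ℝ}
    (h : ∀ t : ℕ, a (t + 1) ≤ (1 - 2 / ((t : ℝ) + 2)) * a t + (2 / ((t : ℝ) + 2)) ^ 2 / 2 * C) :
    ∀ t : ℕ, 1 ≤ t → a t ≤ 2 * C / ((t : ℝ) + 2) := by
  intro t ht
  induction t, ht using Nat.le_induction with
  | base =>
    -- At t = 0 the factor 1 - 2/(t+2) vanishes, so the initial gap is irrelevant: a₁ ≤ C/2 ≤ 2C/3.
    have := h 0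
    norm_num at this ⊢
    linarith
  | succ t ht ih =>
    have ht0 : (0 : ℝ) ≤ t := Nat.cast_nonneg t
    have h1 : 0 ≤ 1 - 2 / ((t : ℝ) + 2) := by linarith [(two_div_add_two_mem t).2]
    calc a (t + 1) ≤ (1 - 2 / ((t : ℝ) + 2)) * a t + (2 / ((t : ℝ) + 2)) ^ 2 / 2 * C := h t
      _ ≤ (1 - 2 / ((t : ℝ) + 2)) * (2 * C / ((t : ℝ) + 2)) +
            (2 / ((t : ℝ) + 2)) ^ 2 / 2 * C := by gcongr
      _ = 2 * C * (((t : ℝ) + 1) / ((t : ℝ) + 2) ^ 2) := by field_simp; ring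
      -- This is (t+1)(t+3) ≤ (t+2)².
      _ ≤ 2 * C * (1 / (((t + 1 : ℕ) : ℝ) + 2)) := by
          refine mul_le_mul_of_nonneg_left ?_ (by linarith)
          rw [div_le_div_iff₀ (by positivity) (by positivity)]
          push_cast
          nlinarith
      _ = _ := by ring

section Convergence

variable {d m n N : ℕ} {Ω : Type*} [MeasurableSpace Ω] {P : Measure Ω}
  {f : Fin n → Mat d m → ℝ} {owner : Fin n → Fin N} {μ L δ : ℝ} {K : ℕ → ℕ}
  {W : ℕ → Ω → Mat d m}

theorem IsDFWTrace.mem_traceBall (h : IsDFWTrace P f owner μ K W) (hμ : 0 < μ)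
    (hconv : Convex ℝ (traceBall d m μ)) (t : ℕ) (ω : Ω) : W t ω ∈ traceBall d m μ := by
  obtain ⟨W₀, hW₀, γ, hγ, v, -, -, -, h0, hstep⟩ := h
  induction t with
  | zero => rwa [h0]
  | succ t ih =>
    rw [hstep]
    exact step_mem_traceBall hconv hγ t ih
      (subproblemSol_mem hμ.le _ (norm_coe_sphere (v t ω)).le _)

/-- The unit sphere of ℝ^0 is empty, so no starting vector could be drawn. -/
theorem IsDFWTrace.dim_pos [IsProbabilityMeasure P] (h : IsDFWTrace P f owner μ K W) : 0 < m := by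
  obtain ⟨W₀, hW₀, γ, hγ, v, -⟩ := h
  obtain ⟨ω⟩ : Nonempty Ω := P.nonempty_of_neZero
  rcases Nat.eq_zero_or_pos m with rfl | hm
  · have h1 := norm_coe_sphere (v 0 ω)
    rw [Subsingleton.elim ((v 0 ω : Vec 0)) 0, norm_zero] at h1
    exact absurd h1 zero_ne_one
  · exact hm

/-- DFW-Trace converges sublinearly in expectation as soon as the expected error of the power
method is small at every epoch. -/
theorem IsDFWTrace.convergesSublinearly [IsProbabilityMeasure P]
    (h : IsDFWTrace P f owner μ K W) (hμ : 0 < μ) (hδ : 0 < δ)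
    (hdiff : ∀ i, ∀ W ∈ traceBall d m μ, DifferentiableAt ℝ (f i) W)
    (hconv : ConvexOn ℝ (traceBall d m μ) (objective f))
    (hLip : ∀ X ∈ traceBall d m μ, ∀ Y ∈ traceBall d m μ,
      |objective f X - objective f Y| ≤ L * traceNorm (X - Y))
    (hbdd : BddAbove (curvatureSet (objective f) μ)) (hC : 0 < curvature (objective f) μ)
    {Wstar : Mat d m} (hWstar : Wstar ∈ traceBall d m μ)
    (herr : ∀ t, ∀ᵐ ω ∂P, ∫⁻ v, ENNReal.ofReal
      (spectralNorm (∑ j, localGrad f owner (W t ω) j) -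
        ritzValue (localGrad f owner (W t ω)) (v : Vec m) (K t)) ∂uniformSphere m ≤
      ENNReal.ofReal (δ * curvature (objective f) μ / (μ * ((t : ℝ) + 2)))) :
    ConvergesSublinearly P (objective f) μ δ Wstar W := by
  have hmem := h.mem_traceBall hμ hconv.1
  obtain ⟨W₀, hW₀, γ, hγ, v, hvm, hvind, hvlaw, h0, hstep⟩ := h
  set F := objective f with hF
  set C := curvature F μ
  have hFdiff : ∀ X ∈ traceBall d m μ, DifferentiableAt ℝ F X := fun X hX =>
    differentiableAt_objective fun i => hdiff i X hX
  have hGm : ∀ j, Measurable fun p : Mat d m × Metric.sphere (0 : Vec m) 1 =>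
      localGrad f owner p.1 j := fun j => (measurable_localGrad f owner j).comp measurable_fst
  have hvec : Measurable fun p : Mat d m × Metric.sphere (0 : Vec m) 1 => (p.2 : Vec m) :=
    measurable_subtype_coe.comp measurable_snd
  -- `Φ t` is one epoch of the algorithm as a measurable function of the iterate and the starting
  -- vector.
  have hind := indepFun_of_recursion (X := W) (v := v)
    (Φ := fun t p => (1 - γ t p.1 (subproblemSol μ (localGrad f owner p.1) (p.2 : Vec m) (K t))) •
      p.1 + γ t p.1 (subproblemSol μ (localGrad f owner p.1) (p.2 : Vec m) (K t)) •
        subproblemSol μ (localGrad f owner p.1) (p.2 : Vec m) (K t))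
    (fun t => by
      have hS := measurable_subproblemSol μ hGm hvec (K t)
      have hg := (hγ.measurable t).comp (measurable_fst.prodMk hS)
      exact ((measurable_const.sub hg).smul measurable_fst).add (hg.smul hS))
    hvm hvind h0 hstep
  have hFB : ∀ X ∈ traceBall d m μ, |F X| ≤ |F 0| + max L 0 * μ := by
    intro X hX
    have h1 := hLip X hX 0 (zero_mem_traceBall hμ.le)
    rw [sub_zero] at h1
    have h2 : L * traceNorm X ≤ max L 0 * μ :=
      mul_le_mul (le_max_left _ _) hX (traceNorm_nonneg _) (le_max_right _ _)
    have h3 := abs_sub_abs_le_abs_sub (F X) (F 0)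
    linarith
  have hFint : ∀ t, Integrable (fun ω => F (W t ω)) P := fun t =>
    integrable_comp_of_mem hFdiff hFB (hind t).1 (hmem t)
  set Φ : ℕ → Mat d m × Metric.sphere (0 : Vec m) 1 → ℝ := fun t p =>
    spectralNorm (∑ j, localGrad f owner p.1 j) -
      ritzValue (localGrad f owner p.1) (p.2 : Vec m) (K t) with hΦ
  have hΦm : ∀ t, Measurable (Φ t) := fun t =>
    (continuous_spectralNorm.measurable.comp (Finset.measurable_fun_sum _ fun j _ => hGm j)).sub
      (measurable_ritzValue hGm hvec (K t))
  have hΦint : ∀ t, Integrable (fun ω => Φ t (W t ω, v t ω)) P := by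
    intro t
    refine Integrable.of_bound (C := 2 * max L 0)
      ((hΦm t).comp ((hind t).1.prodMk (hvm t))).aestronglyMeasurable
      (Filter.Eventually.of_forall fun ω => ?_)
    have h1 := spectralNorm_grad_le hμ hconv.1 hLip (hmem t ω) (hFdiff _ (hmem t ω))
    rw [← sum_localGrad owner fun i => hdiff i _ (hmem t ω)] at h1
    have h2 := abs_ritzValue_le (localGrad f owner (W t ω)) (norm_coe_sphere (v t ω)).le (K t)
    have h3 := spectralNorm_nonneg (∑ j, localGrad f owner (W t ω) j)
    rw [abs_le] at h2
    rw [Real.norm_eq_abs, abs_le, hΦ]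
    constructor <;> simp only <;> linarith
  have hΦle : ∀ t : ℕ, ∫ ω, Φ t (W t ω, v t ω) ∂P ≤ δ * C / (μ * ((t : ℝ) + 2)) := by
    intro t
    refine integral_le_of_lintegral_le (hΦint t) (by positivity) ?_
    refine lintegral_comp_indepFun_le (Φ := fun p => ENNReal.ofReal (Φ t p)) (hind t).1 (hvm t)
      (hind t).2 (hΦm t).ennreal_ofReal ?_
    rw [hvlaw t]
    exact herr t
  have hrec : ∀ t : ℕ, (∫ ω, F (W (t + 1) ω) ∂P - F Wstar) ≤
      (1 - 2 / ((t : ℝ) + 2)) * (∫ ω, F (W t ω) ∂P - F Wstar) +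
        (2 / ((t : ℝ) + 2)) ^ 2 / 2 * (C * (1 + δ)) := by
    intro t
    set g := 2 / ((t : ℝ) + 2) with hg
    have hg0 : 0 < g := (two_div_add_two_mem t).1
    have hpt : ∀ ω, F (W (t + 1) ω) ≤
        (1 - g) * F (W t ω) + g * μ * Φ t (W t ω, v t ω) + (g * F Wstar + g ^ 2 / 2 * C) := by
      intro ω
      rw [hstep]
      have := frankWolfe_step (owner := owner) hμ hdiff hconv hbdd hWstar hγ (hmem t ω)
        (norm_coe_sphere (v t ω)).le (K t) t rfl
      refine this.trans (le_of_eq ?_)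
      rw [hΦ]
      ring
    have hint1 := (hFint t).const_mul (1 - g)
    have hint2 := (hΦint t).const_mul (g * μ)
    have hle := integral_mono (hFint (t + 1)) ((hint1.add hint2).add (integrable_const _)) hpt
    rw [integral_add' (hint1.add hint2) (integrable_const _), integral_add' hint1 hint2,
      integral_const_mul, integral_const_mul, integral_const] at hle
    simp only [probReal_univ, one_smul] at hle
    have h1 := mul_le_mul_of_nonneg_left (hΦle t) (by positivity : 0 ≤ g * μ)
    -- As 1/(t+2) = g/2, the allowed error has the same form as the curvature term, with Cδ in place
    -- of C.
    have h2 : g * μ * (δ * C / (μ * ((t : ℝ) + 2))) = g ^ 2 / 2 * (C * δ) := by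
      rw [hg]
      field_simp
    linarith
  intro t ht
  refine ⟨hFint t, ?_⟩
  have := frankWolfe_recursion (C := C * (1 + δ)) (a := fun t => ∫ ω, F (W t ω) ∂P - F Wstar)
    (by positivity) hrec t ht
  refine this.trans (le_of_eq ?_)
  ring

end Convergence

/-! ### Iteration schedules -/

/-- Serves the degenerate case L ≤ 0, in which the gradients vanish on the ball and the error is
zero for every number of iterations. -/
theorem lintegral_ritzValue_error_eq_zero {d m N : ℕ} {G : Fin N → Mat d m}
    (h : spectralNorm (∑ j, G j) ≤ 0) (K : ℕ) :
    ∫⁻ v, ENNReal.ofReal (spectralNorm (∑ j, G j) - ritzValue G (v : Vec m) K)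
      ∂uniformSphere m = 0 := by
  have h0 : ∀ v : Metric.sphere (0 : Vec m) 1,
      ENNReal.ofReal (spectralNorm (∑ j, G j) - ritzValue G (v : Vec m) K) = 0 := by
    intro v
    have h1 := abs_ritzValue_le G (norm_coe_sphere v).le K
    have h2 := abs_nonneg (ritzValue G (v : Vec m) K)
    have h3 : ritzValue G (v : Vec m) K = 0 := abs_eq_zero.1 (by linarith)
    rw [ENNReal.ofReal_eq_zero, h3, sub_zero]
    exact h
  simp [h0]

theorem exists_succ_of_linearSchedule_le {m : ℕ} {μ L δ C : ℝ} {t K : ℕ} (hm : 8 ≤ m)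
    (hμ : 0 < μ) (hL : 0 < L) (hδ : 0 < δ) (hC : 0 < C)
    (h : linearSchedule m μ L δ C t ≤ (K : ℤ)) :
    ∃ k, K = k + 1 ∧
      L * ((Real.log m + 1) / (2 * k + 1)) ≤ δ * C / (μ * ((t : ℝ) + 2)) := by
  have hm' : (8 : ℝ) ≤ m := by exact_mod_cast hm
  have hlog : 1 ≤ Real.log m := by
    rw [Real.le_log_iff_exp_le (by linarith)]
    linarith [Real.exp_one_lt_d9]
  rw [linearSchedule] at h
  set x := μ * L * ((t : ℝ) + 2) * Real.log m / (δ * C) with hx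
  have hx0 : 0 < x := by positivity
  have hceil : 0 < ⌈x⌉ := Int.ceil_pos.2 hx0
  obtain ⟨k, rfl⟩ : ∃ k, K = k + 1 := ⟨K - 1, by omega⟩
  refine ⟨k, rfl, ?_⟩
  have hk : x ≤ k := by
    have h1 : (⌈x⌉ : ℤ) ≤ (k : ℤ) := by push_cast at h; linarith
    exact_mod_cast Int.ceil_le.1 h1
  rw [hx, div_le_iff₀ (by positivity)] at hk
  rw [mul_div_assoc', div_le_div_iff₀ (by positivity) (by positivity)]
  -- Since log m ≥ 1, log m + 1 ≤ 2 log m; the factor 2 is cancelled by the denominator 2k + 1 ≥ 2k.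
  have h1 : L * (Real.log m + 1) * (μ * ((t : ℝ) + 2)) ≤
      L * (2 * Real.log m) * (μ * ((t : ℝ) + 2)) := by
    gcongr
    linarith
  nlinarith [mul_pos hδ hC]

theorem pow_le_of_logSchedule_le {m : ℕ} {μ L δ C β : ℝ} {t k : ℕ} (hm : 0 < m)
    (hμ : 0 < μ) (hL : 0 < L) (hδ : 0 < δ) (hC : 0 < C) (hβ : 0 < β) (hβ1 : β < 1) {K₀ : ℕ}
    (h : logSchedule m μ L δ C β K₀ t ≤ ((k + 1 : ℕ) : ℤ)) :
    L * (m * β ^ (2 * k + 1)) ≤ δ * C / (μ * ((t : ℝ) + 2)) := by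
  have h1 := (le_max_left _ _).trans h
  set y := (Real.log (δ * C) - Real.log ((m : ℝ) * μ * L * ((t : ℝ) + 2))) / (2 * Real.log β)
    with hy
  have hk : y ≤ k := by
    have h2 : (⌈y⌉ : ℤ) ≤ (k : ℤ) := by push_cast at h1; linarith
    exact_mod_cast Int.ceil_le.1 h2
  have hlogβ : 2 * Real.log β < 0 := by linarith [Real.log_neg hβ hβ1]
  have hm' : (0 : ℝ) < m := by exact_mod_cast hm
  rw [hy, div_le_iff_of_neg hlogβ, ← Real.log_div (by positivity) (by positivity)] at hk
  have hpow : β ^ (2 * k) ≤ δ * C / ((m : ℝ) * μ * L * ((t : ℝ) + 2)) := by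
    rw [← Real.log_le_log_iff (by positivity) (by positivity), Real.log_pow]
    push_cast
    linarith
  -- The schedule controls β^(2k); the spare factor β is dropped.
  calc L * (m * β ^ (2 * k + 1)) ≤ L * (m * β ^ (2 * k)) := by
        gcongr L * (m * ?_)
        exact pow_le_pow_of_le_one hβ.le hβ1.le (Nat.le_succ _)
    _ ≤ L * (m * (δ * C / ((m : ℝ) * μ * L * ((t : ℝ) + 2)))) := by gcongr
    _ = _ := by field_simp

theorem abs_log_mul_le {c x : ℝ} (hx : 1 ≤ x) : |Real.log (c * x)| ≤ |Real.log c| + Real.log x := by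
  rcases eq_or_ne c 0 with rfl | hc
  · simpa using Real.log_nonneg hx
  · rw [Real.log_mul hc (by linarith)]
    exact (abs_add_le _ _).trans (by rw [abs_of_nonneg (Real.log_nonneg hx)])

/-- Only the term log(t+2) varies with t, and it is at most 2 log t once t ≥ 3. The constants are
absorbed using log t ≥ 1. -/
theorem logSchedule_isBigO (m : ℕ) (μ L δ C β : ℝ) (K₀ : ℕ) :
    (fun t : ℕ => (logSchedule m μ L δ C β K₀ t : ℝ)) =O[Filter.atTop]
      fun t : ℕ => Real.log (t : ℝ) := by
  set a := |Real.log (δ * C)|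
  set c := |Real.log ((m : ℝ) * μ * L)|
  set b := |2 * Real.log β|
  refine Asymptotics.IsBigO.of_bound ((a + c + 2) / b + 2 + K₀) ?_
  filter_upwards [Filter.eventually_ge_atTop 3] with t ht
  have ht' : (3 : ℝ) ≤ t := by exact_mod_cast ht
  have hlog : 1 ≤ Real.log t := by
    rw [Real.le_log_iff_exp_le (by linarith)]
    linarith [Real.exp_one_lt_d9]
  have hlog2 : Real.log ((t : ℝ) + 2) ≤ 2 * Real.log t := by
    have h2 : 2 * Real.log (t : ℝ) = Real.log ((t : ℝ) ^ 2) := by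
      rw [Real.log_pow]
      norm_num
    rw [h2]
    exact Real.log_le_log (by linarith) (by nlinarith)
  rw [Real.norm_eq_abs, Real.norm_eq_abs, abs_of_nonneg (zero_le_one.trans hlog), logSchedule]
  set y := (Real.log (δ * C) - Real.log ((m : ℝ) * μ * L * ((t : ℝ) + 2))) / (2 * Real.log β)
    with hy
  have hya : |y| ≤ (a + c + 2) / b * Real.log t := by
    rw [hy, abs_div, div_mul_eq_mul_div]
    refine div_le_div_of_nonneg_right ?_ (abs_nonneg _)
    have h1 := abs_sub (Real.log (δ * C)) (Real.log ((m : ℝ) * μ * L * ((t : ℝ) + 2)))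
    have h2 := abs_log_mul_le (c := (m : ℝ) * μ * L) (x := (t : ℝ) + 2) (by linarith)
    have h3 : 0 ≤ a := abs_nonneg _
    have h4 : 0 ≤ c := abs_nonneg _
    nlinarith
  have hceil : |((⌈y⌉ + 1 : ℤ) : ℝ)| ≤ |y| + 2 := by
    have h1 := Int.ceil_lt_add_one y
    have h2 := Int.le_ceil y
    push_cast
    rw [abs_le]
    constructor <;> linarith [neg_abs_le y, le_abs_self y]
  have hmax : |((max (⌈y⌉ + 1) (K₀ : ℤ) : ℤ) : ℝ)| ≤ |((⌈y⌉ + 1 : ℤ) : ℝ)| + K₀ := by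
    have h1 : (0 : ℝ) ≤ K₀ := Nat.cast_nonneg _
    rcases max_choice (⌈y⌉ + 1) (K₀ : ℤ) with h | h
    · rw [h]
      linarith
    · rw [h, Int.cast_natCast, abs_of_nonneg h1]
      linarith [abs_nonneg ((⌈y⌉ + 1 : ℤ) : ℝ)]
  have hK : (K₀ : ℝ) ≤ K₀ * Real.log t := le_mul_of_one_le_right (Nat.cast_nonneg _) hlog
  calc _ ≤ |((⌈y⌉ + 1 : ℤ) : ℝ)| + K₀ := hmax
    _ ≤ (a + c + 2) / b * Real.log t + 2 * Real.log t + K₀ * Real.log t := by linarith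
    _ = _ := by ring

end DFWTrace

/-! ### The main theorem -/

theorem theorem2 {d m n N : ℕ}
    (f : Fin n → DFWTrace.Mat d m → ℝ) (owner : Fin n → Fin N) (μ L δ : ℝ)
    (hμ : 0 < μ) (hδ : 0 < δ)
    (hdiff : ∀ i, ∀ W ∈ DFWTrace.traceBall d m μ, DifferentiableAt ℝ (f i) W)
    (hconv : ConvexOn ℝ (DFWTrace.traceBall d m μ) (DFWTrace.objective f))
    (hLip : ∀ X ∈ DFWTrace.traceBall d m μ, ∀ Y ∈ DFWTrace.traceBall d m μ,
      |DFWTrace.objective f X - DFWTrace.objective f Y| ≤ L * DFWTrace.traceNorm (X - Y))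
    (hbdd : BddAbove (DFWTrace.curvatureSet (DFWTrace.objective f) μ))
    (hC : 0 < DFWTrace.curvature (DFWTrace.objective f) μ)
    (Wstar : DFWTrace.Mat d m) (hWstar : Wstar ∈ DFWTrace.traceBall d m μ)
    (hmin : IsMinOn (DFWTrace.objective f) (DFWTrace.traceBall d m μ) Wstar) :
    -- First regime: no assumption on the spectrum of the gradients.
    (8 ≤ m →
      ∀ {Ω : Type*} [MeasurableSpace Ω] (P : Measure Ω) [IsProbabilityMeasure P]
        (K : ℕ → ℕ) (W : ℕ → Ω → DFWTrace.Mat d m),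
        DFWTrace.IsDFWTrace P f owner μ K W →
        (∀ t, DFWTrace.linearSchedule m μ L δ
            (DFWTrace.curvature (DFWTrace.objective f) μ) t ≤ (K t : ℤ)) →
        DFWTrace.ConvergesSublinearly P (DFWTrace.objective f) μ δ Wstar W) ∧
    -- Second regime: the top singular value of each gradient is simple, with a uniform gap.
    (∀ β : ℝ, 0 < β → β < 1 → ∃ Ktilde : ℕ,
      ((fun t : ℕ => (DFWTrace.logSchedule m μ L δ
          (DFWTrace.curvature (DFWTrace.objective f) μ) β Ktilde t : ℝ))
        =O[Filter.atTop] fun t : ℕ => Real.log (t : ℝ)) ∧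
      ∀ {Ω : Type*} [MeasurableSpace Ω] (P : Measure Ω) [IsProbabilityMeasure P]
        (K : ℕ → ℕ) (W : ℕ → Ω → DFWTrace.Mat d m),
        DFWTrace.IsDFWTrace P f owner μ K W →
        (∀ᵐ ω ∂P, ∀ t,
          DFWTrace.singVal (DFWTrace.grad (DFWTrace.objective f) (W t ω)) 1 <
            DFWTrace.singVal (DFWTrace.grad (DFWTrace.objective f) (W t ω)) 0 ∧
          DFWTrace.singVal (DFWTrace.grad (DFWTrace.objective f) (W t ω)) 1 /
            DFWTrace.singVal (DFWTrace.grad (DFWTrace.objective f) (W t ω)) 0 < β) →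
        (∀ t, DFWTrace.logSchedule m μ L δ
            (DFWTrace.curvature (DFWTrace.objective f) μ) β Ktilde t ≤ (K t : ℤ)) →
        DFWTrace.ConvergesSublinearly P (DFWTrace.objective f) μ δ Wstar W) := by
  have herrL : ∀ W ∈ DFWTrace.traceBall d m μ,
      DFWTrace.spectralNorm (∑ j, DFWTrace.localGrad f owner W j) ≤ max L 0 := by
    intro W hW
    rw [DFWTrace.sum_localGrad owner fun i => hdiff i W hW]
    exact DFWTrace.spectralNorm_grad_le hμ hconv.1 hLip hW
      (DFWTrace.differentiableAt_objective fun i => hdiff i W hW)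
  -- The constant 1 suffices: it only ensures that at least one power iteration is made, since the
  -- logarithmic expression can be nonpositive for small t.
  refine ⟨?_, fun β hβ hβ1 => ⟨1, DFWTrace.logSchedule_isBigO _ _ _ _ _ _ _, ?_⟩⟩
  · intro hm8 Ω _ P _ K W hrun hK
    refine hrun.convergesSublinearly hμ hδ hdiff hconv hLip hbdd hC hWstar fun t =>
      Filter.Eventually.of_forall fun ω => ?_
    have hσ := herrL _ (hrun.mem_traceBall hμ hconv.1 t ω)
    rcases le_or_gt L 0 with hL | hL
    · rw [max_eq_right hL] at hσ
      rw [DFWTrace.lintegral_ritzValue_error_eq_zero hσ]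
      exact zero_le
    · rw [max_eq_left hL.le] at hσ
      obtain ⟨k, hk, hbound⟩ :=
        DFWTrace.exists_succ_of_linearSchedule_le hm8 hμ hL hδ hC (hK t)
      rw [hk]
      refine (DFWTrace.lintegral_spectralNorm_sub_ritzValue_le_log hrun.dim_pos _ k).trans
        (ENNReal.ofReal_le_ofReal (le_trans ?_ hbound))
      have : 0 ≤ Real.log (m : ℝ) := Real.log_natCast_nonneg m
      gcongr
  · intro Ω _ P _ K W hrun hgap hK
    refine hrun.convergesSublinearly hμ hδ hdiff hconv hLip hbdd hC hWstar fun t =>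
      hgap.mono fun ω hω => ?_
    have hmem := hrun.mem_traceBall hμ hconv.1 t ω
    have hσ := herrL _ hmem
    rcases le_or_gt L 0 with hL | hL
    · rw [max_eq_right hL] at hσ
      rw [DFWTrace.lintegral_ritzValue_error_eq_zero hσ]
      exact zero_le
    · rw [max_eq_left hL.le] at hσ
      have hK1 : 1 ≤ K t := by
        have := (le_max_right _ _).trans (hK t)
        exact_mod_cast this
      obtain ⟨k, hk⟩ : ∃ k, K t = k + 1 := ⟨K t - 1, by omega⟩
      have hKt := hK t
      rw [hk] at hKt ⊢
      obtain ⟨hlt, hratio⟩ := hω t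
      have hpos := (DFWTrace.singVal_nonneg _ 1).trans_lt hlt
      rw [div_lt_iff₀ hpos, ← DFWTrace.sum_localGrad owner fun i => hdiff i _ hmem] at hratio
      refine (DFWTrace.lintegral_spectralNorm_sub_ritzValue_le_gap hrun.dim_pos _ k hβ
        hratio.le).trans (ENNReal.ofReal_le_ofReal (le_trans ?_
          (DFWTrace.pow_le_of_logSchedule_le hrun.dim_pos hμ hL hδ hC hβ hβ1 hKt)))
      gcongr
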